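/- Let $m\ge 1$ be an integer. For $n\ge m$ let $G_m(\mathbb C^n)$ be the Grassmann manifold of $m$-dimensional complex subspaces of $\mathbb C^n$, let $\mathbb U(n)$ be the unitary group, and let $$\chi_m(\mathbb C^n)=\{(\Sigma,u)\in G_m(\mathbb C^n)\times\mathbb U(n)\;:\; u(\Sigma)=\Sigma,\ u|_{\Sigma^\perp}=\mathrm{Id}_{\Sigma^\perp}\}$$ with the subspace topology. The inclusions $\mathbb C^n\subset\mathbb C^{n+1}$, $v\mapsto(v,0)$, and $\mathbb U(n)\subset\mathbb U(n+1)$, $u\mapsto\mathrm{diag}(u,1)$, induce inclusions $\chi_m(\mathbb C^n)\subset\chi_m(\mathbb C^{n+1})$. Let $\mathbb B_\chi^m=\bigcup_{n\ge m}\chi_m(\mathbb C^n)$ with the direct limit topology. Then $\mathbb B_\chi^m$ is non-empty, and for every base point $b\in\mathbb B_\chi^m$ and every base point $g\in\mathbb U(m)$ one has $\pi_0(\mathbb B_\chi^m,b)=0$ (that is, $\mathbb B_\chi^m$ is path-connected), and for every integer $k\ge1$ there is an isomorphism of groups $$\pi_k(\mathbb B_\chi^m,b)\;\simeq\;\pi_k(\mathbb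 U(m),g)\oplus\pi_{k-1}(\mathbb U(m),g),$$ where, for $k=1$, $\pi_0(\mathbb U(m))$ denotes the group of path components of the topological group $\mathbb U(m)$. -/

import Mathlib

open scoped Topology

noncomputable section

/-- The Grassmannian `G_m(ℂⁿ)`: the `m`-dimensional complex subspaces of `ℂⁿ`. -/
def Grass (m n : ℕ) : Type :=
  {S : Submodule ℂ (EuclideanSpace ℂ (Fin n)) // Module.finrank ℂ S = m}

/-- The usual topology of the Grassmannian: a subspace is identified with the orthogonal
projection onto it, and projections are topologised as bounded operators on `ℂⁿ`. -/
instance Grass.topologicalSpace (m n : ℕ) : TopologicalSpace (Grass m n) :=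
  TopologicalSpace.induced (fun S => S.1.starProjection) inferInstance

/-- The unitary group `U(n)` of complex `n × n` matrices. -/
abbrev U (n : ℕ) : Type := Matrix.unitaryGroup (Fin n) ℂ

/-- The action of a matrix on `ℂⁿ`. -/
abbrev U.act {n : ℕ} (u : U n) : EuclideanSpace ℂ (Fin n) →ₗ[ℂ] EuclideanSpace ℂ (Fin n) :=
  Matrix.toEuclideanLin u.1

/-- The space `χ_m(ℂⁿ)` of pairs `(Σ, u)` of an `m`-dimensional subspace `Σ` of `ℂⁿ` and a unitary
`u ∈ U(n)` with `u(Σ) = Σ` which is the identity on the orthogonal complement of `Σ`.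
It carries the subspace topology of `G_m(ℂⁿ) × U(n)`. -/
abbrev Chi (m n : ℕ) : Type :=
  {p : Grass m n × U n //
    p.1.1.map (U.act p.2) = p.1.1 ∧ ∀ v ∈ p.1.1ᗮ, U.act p.2 v = v}

/-- The inclusion `v ↦ (v, 0, 0, …)` of `ℂⁿ` into `ℂ^∞`, the space of finitely supported
sequences. -/
def padVec (n : ℕ) : EuclideanSpace ℂ (Fin n) →ₗ[ℂ] (ℕ →₀ ℂ) :=
  Finsupp.lmapDomain ℂ ℂ (Fin.val : Fin n → ℕ) ∘ₗ
    (Finsupp.linearEquivFunOnFinite ℂ ℂ (Fin n)).symm.toLinearMap ∘ₗ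
      (WithLp.linearEquiv 2 ℂ (Fin n → ℂ)).toLinearMap

/-- The infinite matrix `diag(A, 1, 1, …)`. -/
def padMat {n : ℕ} (A : Matrix (Fin n) (Fin n) ℂ) : Matrix ℕ ℕ ℂ := fun i j =>
  if h : i < n ∧ j < n then A ⟨i, h.1⟩ ⟨j, h.2⟩ else if i = j then 1 else 0

/-- The inclusion of `χ_m(ℂⁿ)` into pairs (subspace of `ℂ^∞`, infinite matrix). These maps are
compatible with the inclusions `χ_m(ℂⁿ) ⊆ χ_m(ℂⁿ⁺¹)` given by `ℂⁿ ⊆ ℂⁿ⁺¹` and `U(n) ⊆ U(n+1)`. -/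
def Chi.pad {m n : ℕ} (p : Chi m n) : Submodule ℂ (ℕ →₀ ℂ) × Matrix ℕ ℕ ℂ :=
  (p.1.1.1.map (padVec n), padMat p.1.2.1)

/-- The classifying space: the union of the increasing family `χ_m(ℂⁿ)`. -/
def BChi (m : ℕ) : Type :=
  {x : Submodule ℂ (ℕ →₀ ℂ) × Matrix ℕ ℕ ℂ // ∃ (n : ℕ) (p : Chi m n), p.pad = x}

/-- The inclusion of `χ_m(ℂⁿ)` into the classifying space. -/
def BChi.incl (m n : ℕ) (p : Chi m n) : BChi m := ⟨p.pad, n, p, rfl⟩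

/-- The direct limit topology: a set is open iff its trace on every `χ_m(ℂⁿ)` is open. -/
instance BChi.topologicalSpace (m : ℕ) : TopologicalSpace (BChi m) :=
  ⨆ n : ℕ, TopologicalSpace.coinduced (BChi.incl m n) inferInstance

end

open scoped unitInterval Topology.Homotopy

noncomputable section

/-! Call frame an `m`-tuple of orthonormal vectors in some `ℂⁿ ⊆ ℂ^∞`. A frame `A` and a matrix `g ∈
U(m)` determine a point of `BChi m`: the span of `A`, with the unitary acting on it as `g` in the
frame `A`. Every point arises so, and `(A * C, g)` gives the same point as `(A, C * g * C⁻¹)`. Thus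
the classifying space is the bundle with fibre `U(m)`, by conjugation, associated with the universal
principal `U(m)`-bundle.

Frames lift along homotopies, and the space of frames is contractible. The frames over the base
point are the `stdFrame m * C`, always paired with the unitary `1`, because conjugation fixes `1`.
Hence if a loop `f` of dimension `k` is lifted starting from the standard frame, its unitary part
`g` is `1` on the whole boundary, and the frame reached on the last face is a rotation `h` of the
standard one. The pair `(g, h)` of loops of dimensions `k` and `k - 1` is the required
decomposition; it replaces the splitting of the long exact sequence of the bundle.

`IsFramedBy` records this as a relation between `f` and `(g, h)`, and `nonempty_mulEquiv_of_rel`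
makes it an isomorphism. Totality and triviality of the kernels rest on two facts: lifting
(`BChi.exists_frame_lift`) and extension of frames from closed sets
(`exists_isFrameFamily_extension`). For `k = 1`, connectedness of `U(m)` makes `h` constant. Base
points are moved by `HomotopyGroup.nonempty_mulEquiv_of_joined`. -/

/-- A multiplicative relation between two groups which is total on both sides and has trivial
kernels on both sides is the graph of an isomorphism. -/
theorem nonempty_mulEquiv_of_rel {G H : Type*} [Group G] [Group H] (R : G → H → Prop)
    (hmul : ∀ {a a' b b'}, R a b → R a' b' → R (a * a') (b * b'))
    (hleft : ∀ a, ∃ b, R a b) (hright : ∀ b, ∃ a, R a b)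
    (hkl : ∀ b, R 1 b → b = 1) (hkr : ∀ a, R a 1 → a = 1) : Nonempty (G ≃* H) := by
  have huniq : ∀ {a b b'}, R a b → R a b' → b = b' := by
    intro a b b' h h'
    obtain ⟨c, hc⟩ := hleft a⁻¹
    have h1 := hkl _ (by simpa using hmul h hc)
    have h2 := hkl _ (by simpa using hmul h' hc)
    exact mul_right_cancel (h1.trans h2.symm)
  have huniq' : ∀ {a a' b}, R a b → R a' b → a = a' := by
    intro a a' b h h'
    obtain ⟨c, hc⟩ := hright b⁻¹
    have h1 := hkr _ (by simpa using hmul h hc)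
    have h2 := hkr _ (by simpa using hmul h' hc)
    exact mul_right_cancel (h1.trans h2.symm)
  choose φ hφ using hleft
  choose ψ hψ using hright
  exact ⟨{ toFun := φ, invFun := ψ
           left_inv := fun a => huniq' (hψ _) (hφ a)
           right_inv := fun b => huniq (hφ _) (hψ b)
           map_mul' := fun a a' => huniq (hφ _) (hmul (hφ a) (hφ a')) }⟩

/-! ### Loops on cubes, collars and change of base point -/

section Cube

variable {N X : Type*} [TopologicalSpace X]

theorem GenLoop.homotopic_of {x : X} {f g : Ω^ N X x} (F : I × (N → I) → X) (hF : Continuous F)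
    (h0 : ∀ z, F (0, z) = f z) (h1 : ∀ z, F (1, z) = g z)
    (hb : ∀ s, ∀ z ∈ Cube.boundary N, F (s, z) = x) : GenLoop.Homotopic f g :=
  ⟨{ toFun := F, continuous_toFun := hF, map_zero_left := h0, map_one_left := h1
     prop' := fun s z hz => (hb s z hz).trans (f.2 z hz).symm }⟩

theorem GenLoop.Homotopic.exists_fun {x : X} {f g : Ω^ N X x} (h : GenLoop.Homotopic f g) :
    ∃ F : I × (N → I) → X, Continuous F ∧ (∀ z, F (0, z) = f z) ∧ (∀ z, F (1, z) = g z) ∧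
      ∀ s, ∀ z ∈ Cube.boundary N, F (s, z) = x := by
  obtain ⟨F⟩ := h
  exact ⟨F, F.continuous, F.apply_zero, F.apply_one,
    fun s z hz => (F.eq_fst s hz).trans (f.2 z hz)⟩

theorem GenLoop.transAt_apply [DecidableEq N] {x : X} (i : N) (f g : Ω^ N X x) (t : N → I) :
    GenLoop.transAt i f g t = if (t i : ℝ) ≤ 1 / 2
      then f (Function.update t i <| Set.projIcc 0 1 zero_le_one (2 * t i))
      else g (Function.update t i <| Set.projIcc 0 1 zero_le_one (2 * t i - 1)) := rfl

/-- Gluing two maps on a cube along the `i`th coordinate, with parameters. -/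
theorem continuous_glueAt [DecidableEq N] {Y : Type*} [TopologicalSpace Y] (i : N)
    {f g : Y × (N → I) → X} (hf : Continuous f) (hg : Continuous g)
    (h : ∀ y z z', z i = 1 → z' i = 0 → (∀ j, j ≠ i → z j = z' j) → f (y, z) = g (y, z')) :
    Continuous fun p : Y × (N → I) => if (p.2 i : ℝ) ≤ 1 / 2
      then f (p.1, Function.update p.2 i <| Set.projIcc 0 1 zero_le_one (2 * p.2 i))
      else g (p.1, Function.update p.2 i <| Set.projIcc 0 1 zero_le_one (2 * p.2 i - 1)) := by
  refine Continuous.if_le ?_ ?_ (by fun_prop) (by fun_prop) ?_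
  · refine hf.comp (continuous_fst.prodMk (continuous_snd.update i ?_))
    exact continuous_projIcc.comp (by fun_prop)
  · refine hg.comp (continuous_fst.prodMk (continuous_snd.update i ?_))
    exact continuous_projIcc.comp (by fun_prop)
  · intro p hp
    refine h _ _ _ ?_ ?_ ?_
    · simp [hp]
    · simp [hp]
    · intro j hj; simp [Function.update_of_ne hj]

/-- Expansion of the cube about its centre. -/
def collarExpand (t : I) (x : N → I) : N → I := fun i =>
  Set.projIcc 0 1 zero_le_one ((1 + (t : ℝ)) * x i - t / 2)

theorem continuous_collarExpand : Continuous fun p : I × (N → I) => collarExpand p.1 p.2 := by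
  refine continuous_pi fun i => continuous_projIcc.comp (by fun_prop)

theorem collarExpand_zero (x : N → I) : collarExpand 0 x = x := by
  ext i; simp [collarExpand]

/-- Two loops related by a free homotopy whose boundary runs along `γ`. -/
def GenLoop.FreelyHomotopic {x y : X} (γ : Path x y) (f : Ω^ N X x) (g : Ω^ N X y) : Prop :=
  ∃ K : f.1.Homotopy g.1, ∀ s, ∀ z ∈ Cube.boundary N, K (s, z) = γ s

theorem GenLoop.FreelyHomotopic.symm {x y : X} {γ : Path x y} {f : Ω^ N X x} {g : Ω^ N X y}
    (h : GenLoop.FreelyHomotopic γ f g) : GenLoop.FreelyHomotopic γ.symm g f := by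
  obtain ⟨K, hK⟩ := h
  exact ⟨K.symm, fun s z hz => by simp [hK _ z hz]⟩

theorem GenLoop.FreelyHomotopic.transAt [DecidableEq N] (i : N) {x y : X} {γ : Path x y}
    {f f' : Ω^ N X x} {g g' : Ω^ N X y} (h : GenLoop.FreelyHomotopic γ f g)
    (h' : GenLoop.FreelyHomotopic γ f' g') :
    GenLoop.FreelyHomotopic γ (GenLoop.transAt i f f') (GenLoop.transAt i g g') := by
  obtain ⟨K, hK⟩ := h
  obtain ⟨K', hK'⟩ := h'
  have hc := continuous_glueAt i K.continuous K'.continuous (fun s z z' hz hz' _ => by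
    rw [hK s z ⟨i, Or.inr hz⟩, hK' s z' ⟨i, Or.inl hz'⟩])
  refine ⟨⟨⟨_, hc⟩, ?_, ?_⟩, ?_⟩
  · intro z; simp only [K.apply_zero, K'.apply_zero]; rfl
  · intro z; simp only [K.apply_one, K'.apply_one]; rfl
  · intro s z hz
    change (if _ then _ else _) = _
    obtain ⟨j, hj⟩ := hz
    dsimp only
    by_cases hij : j = i
    · subst hij
      rcases hj with hj | hj
      · rw [if_pos (by simp [hj]), hK]
        exact ⟨j, Or.inl (by simp [hj])⟩
      · rw [if_neg (by norm_num [hj]), hK']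
        refine ⟨j, Or.inr ?_⟩
        simp only [hj, Function.update_self, Set.Icc.coe_one]
        exact Set.projIcc_of_right_le _ (by norm_num)
    · split_ifs
      · exact hK _ _ ⟨j, by simpa [Function.update_of_ne hij] using hj⟩
      · exact hK' _ _ ⟨j, by simpa [Function.update_of_ne hij] using hj⟩

variable [Fintype N]

/-- The signed size of the collar of width growing with `t` around a point of the cube. -/
def collarDepth (t : I) (x : N → I) : ℝ :=
  -- In the sup metric this vanishes where `collarExpand t` first reaches a face, and it equals `t`
  -- on the boundary of the cube.
  (1 + (t : ℝ)) * 2 * dist (fun i => (x i : ℝ)) (fun _ => 1 / 2) - 1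

theorem continuous_collarDepth : Continuous fun p : I × (N → I) => collarDepth p.1 p.2 := by
  unfold collarDepth; fun_prop

theorem dist_center_le (x : N → I) :
    dist (fun i => (x i : ℝ)) (fun _ => 1 / 2) ≤ 1 / 2 := by
  rw [dist_pi_le_iff (by norm_num)]
  intro i
  rw [Real.dist_eq, abs_le]
  constructor <;> linarith [(x i).2.1, (x i).2.2]

theorem collarDepth_zero_le (x : N → I) : collarDepth 0 x ≤ 0 := by
  have := dist_center_le x
  simp only [collarDepth, Set.Icc.coe_zero]; linarith

theorem collarDepth_boundary (t : I) {x : N → I} (hx : x ∈ Cube.boundary N) :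
    collarDepth t x = t := by
  have h : dist (fun i => (x i : ℝ)) (fun _ => 1 / 2) = 1 / 2 := by
    refine le_antisymm (dist_center_le x) ?_
    obtain ⟨i, hi⟩ := hx
    refine le_trans ?_ (dist_le_pi_dist (fun i => (x i : ℝ)) (fun _ => 1 / 2) i)
    rcases hi with hi | hi <;> rw [hi, Real.dist_eq] <;> norm_num
  rw [collarDepth, h]; ring

/-- Some coordinate is at distance at least `1 / (2 * (1 + t))` from `1 / 2`; the expansion sends it
to a face or beyond, and the clamping brings it back to the face. -/
theorem collarExpand_mem_boundary [Nonempty N] (t : I) {x : N → I} (hx : 0 ≤ collarDepth t x) :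
    collarExpand t x ∈ Cube.boundary N := by
  have ht : (0 : ℝ) < 1 + t := by linarith [t.2.1]
  have : ∃ i, 1 / ((1 + (t : ℝ)) * 2) ≤ dist (x i : ℝ) (1 / 2) := by
    by_contra! hcon
    have := (dist_pi_lt_iff (f := fun i => (x i : ℝ)) (g := fun _ => 1 / 2)
      (by positivity : 0 < 1 / ((1 + (t : ℝ)) * 2))).2 hcon
    rw [lt_div_iff₀ (by positivity)] at this
    unfold collarDepth at hx
    linarith
  obtain ⟨i, hi⟩ := this
  refine ⟨i, ?_⟩
  rw [div_le_iff₀ (by positivity), Real.dist_eq] at hi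
  rcases le_total ((x i : ℝ) - 1 / 2) 0 with h | h
  · left
    rw [abs_of_nonpos h] at hi
    exact Set.projIcc_of_le_left _ (by linarith)
  · right
    rw [abs_of_nonneg h] at hi
    exact Set.projIcc_of_right_le _ (by linarith)

/-- Extension of a family of maps on the cube along a family of paths on its boundary. -/
def collarGlue {Y : Type*} (f : Y × (N → I) → X) (δ : Y × I → X) (p : Y × I × (N → I)) : X :=
  if collarDepth p.2.1 p.2.2 ≤ 0 then f (p.1, collarExpand p.2.1 p.2.2)
  else δ (p.1, Set.projIcc 0 1 zero_le_one (collarDepth p.2.1 p.2.2))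

theorem continuous_collarGlue [Nonempty N] {Y : Type*} [TopologicalSpace Y]
    {f : Y × (N → I) → X} {δ : Y × I → X} (hf : Continuous f) (hδ : Continuous δ)
    (h : ∀ y, ∀ z ∈ Cube.boundary N, f (y, z) = δ (y, 0)) : Continuous (collarGlue f δ) := by
  have hD : Continuous fun p : Y × I × (N → I) => collarDepth p.2.1 p.2.2 :=
    continuous_collarDepth.comp continuous_snd
  refine Continuous.if_le ?_ ?_ hD continuous_const ?_
  · exact hf.comp (continuous_fst.prodMk (continuous_collarExpand.comp continuous_snd))
  · exact hδ.comp (continuous_fst.prodMk (continuous_projIcc.comp hD))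
  · intro p hp
    rw [h _ _ (collarExpand_mem_boundary _ hp.ge), hp, Set.projIcc_left]
    rfl

theorem collarGlue_zero {N X : Type*} [Fintype N] {Y : Type*} (f : Y × (N → I) → X) (δ : Y × I → X) (y : Y) (z : N → I) :
    collarGlue f δ (y, 0, z) = f (y, z) := by
  simp [collarGlue, collarDepth_zero_le, collarExpand_zero]

theorem collarGlue_boundary {N X : Type*} [Fintype N] {Y : Type*} {f : Y × (N → I) → X} {δ : Y × I → X}
    (h : ∀ y, ∀ z ∈ Cube.boundary N, f (y, z) = δ (y, 0)) (y : Y) (t : I) {z : N → I}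
    (hz : z ∈ Cube.boundary N) : collarGlue f δ (y, t, z) = δ (y, t) := by
  unfold collarGlue
  simp only [collarDepth_boundary t hz]
  split_ifs with ht
  · have h0 : t = 0 := Subtype.ext (le_antisymm ht t.2.1)
    subst h0
    rw [collarExpand_zero, h y z hz]
  · rw [Set.projIcc_val]

/-- A loop which is freely homotopic to a constant map, through maps that are constant on the
boundary, is null homotopic. -/
theorem GenLoop.homotopic_const_of_free [Nonempty N] {x : X} {f : Ω^ N X x} {y : X}
    (K : I × (N → I) → X) (hK : Continuous K) (h0 : ∀ z, K (0, z) = f z) (h1 : ∀ z, K (1, z) = y)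
    (γ : I → X) (hγ : Continuous γ) (hb : ∀ s, ∀ z ∈ Cube.boundary N, K (s, z) = γ s) :
    GenLoop.Homotopic f GenLoop.const := by
  have z0 : (fun _ => 0 : N → I) ∈ Cube.boundary N :=
    ⟨Classical.arbitrary N, Or.inl rfl⟩
  have hγ0 : γ 0 = x := by rw [← hb 0 _ z0, h0]; exact f.2 _ z0
  have hγ1 : γ 1 = y := by rw [← hb 1 _ z0, h1]
  -- The collar runs back along `γ` from `γ s` to `γ 0 = x`, so that every stage of `K` becomes a
  -- loop at `x`.
  set δ : I × I → X := fun p => γ (p.1 * σ p.2) with hδ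
  have hδc : Continuous δ := by fun_prop
  have hc : ∀ s, ∀ z ∈ Cube.boundary N, K (s, z) = δ (s, 0) := by
    intro s z hz; simp [hδ, hb s z hz]
  have hH := continuous_collarGlue hK hδc hc
  have hbd := fun s t z hz => collarGlue_boundary hc s t (z := z) hz
  set H := collarGlue K δ with hHdef
  let f1 : Ω^ N X x := ⟨⟨fun z => H (0, 1, z), by fun_prop⟩, fun z hz => by
    change H (0, 1, z) = x
    rw [hbd _ _ _ hz]; simp [hδ, hγ0]⟩
  let f2 : Ω^ N X x := ⟨⟨fun z => H (1, 1, z), by fun_prop⟩, fun z hz => by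
    change H (1, 1, z) = x
    rw [hbd _ _ _ hz]; simp [hδ, hγ0]⟩
  have e1 : GenLoop.Homotopic f f1 := by
    refine GenLoop.homotopic_of (fun p => H (0, p.1, p.2)) (by fun_prop) ?_ (fun _ => rfl) ?_
    · intro z; rw [hHdef, collarGlue_zero, h0]
    · intro s z hz; rw [hbd _ _ _ hz]; simp [hδ, hγ0]
  have e2 : GenLoop.Homotopic f1 f2 := by
    refine GenLoop.homotopic_of (fun p => H (p.1, 1, p.2)) (by fun_prop) (fun _ => rfl)
      (fun _ => rfl) ?_
    intro s z hz; rw [hbd _ _ _ hz]; simp [hδ, hγ0]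
  -- Since `K` ends at a constant, `f2` is `γ` composed with a function of the depth; scaling the
  -- parameter of `γ` to `0` contracts it.
  have e3 : GenLoop.Homotopic f2 GenLoop.const := by
    refine GenLoop.homotopic_of
      (fun p => γ (σ p.1 * σ (Set.projIcc 0 1 zero_le_one (collarDepth 1 p.2)))) ?_ ?_ ?_ ?_
    · have : Continuous fun p : I × (N → I) => collarDepth 1 p.2 :=
        continuous_collarDepth.comp (continuous_const.prodMk continuous_snd)
      have := (continuous_projIcc (h := zero_le_one (α := ℝ))).comp this
      exact hγ.comp ((unitInterval.continuous_symm.comp continuous_fst).mul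
        (unitInterval.continuous_symm.comp this))
    · intro z
      change _ = collarGlue K δ (1, 1, z)
      unfold collarGlue
      split_ifs with hD
      · simp only at hD ⊢
        rw [Set.projIcc_of_le_left _ hD, h1]
        change γ (σ 0 * σ 0) = y
        simp [hγ1]
      · simp [hδ]
    · intro z; simp [hγ0]
    · intro s z hz
      simp [collarDepth_boundary 1 hz, hγ0]
  exact e1.trans (e2.trans e3)

/-- The collar construction with a one-point parameter space. -/
theorem GenLoop.exists_free_homotopy [Nonempty N] {x y : X} (γ : Path x y) (f : Ω^ N X x) :
    ∃ (g : Ω^ N X y) (K : C(I × (N → I), X)), (∀ z, K (0, z) = f z) ∧ (∀ z, K (1, z) = g z) ∧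
      ∀ s, ∀ z ∈ Cube.boundary N, K (s, z) = γ s := by
  let F : Unit × (N → I) → X := fun p => f p.2
  let δ : Unit × I → X := fun p => γ p.2
  have hF : Continuous F := f.1.continuous.comp continuous_snd
  have hc : ∀ u, ∀ z ∈ Cube.boundary N, F (u, z) = δ (u, 0) := fun u z hz => by
    simp only [F, δ, γ.source]; exact f.2 z hz
  have hH := continuous_collarGlue hF (δ := δ) (by fun_prop) hc
  have hbd := fun s t z hz => collarGlue_boundary hc s t (z := z) hz
  refine ⟨⟨⟨fun z => collarGlue F δ ((), 1, z), by fun_prop⟩, fun z hz => ?_⟩,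
    ⟨fun p => collarGlue F δ ((), p.1, p.2), by fun_prop⟩, ?_, fun _ => rfl, ?_⟩
  · change collarGlue F δ ((), 1, z) = y
    rw [hbd _ _ _ hz]; exact γ.target
  · intro z
    change collarGlue F δ ((), 0, z) = f z
    rw [collarGlue_zero]
  · intro s z hz; exact hbd _ _ _ hz

theorem GenLoop.exists_freelyHomotopic [Nonempty N] {x y : X} (γ : Path x y) (f : Ω^ N X x) :
    ∃ g, GenLoop.FreelyHomotopic γ f g := by
  obtain ⟨g, K, h0, h1, hb⟩ := GenLoop.exists_free_homotopy γ f
  exact ⟨g, ⟨⟨K, h0, h1⟩, hb⟩⟩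

theorem GenLoop.FreelyHomotopic.homotopic_const [Nonempty N] {x y : X} {γ : Path x y}
    {f : Ω^ N X x} {g : Ω^ N X y} (h : GenLoop.FreelyHomotopic γ f g)
    (hg : GenLoop.Homotopic g GenLoop.const) : GenLoop.Homotopic f GenLoop.const := by
  obtain ⟨K, hK⟩ := h
  obtain ⟨H⟩ := hg
  have hb : ∀ s, ∀ z ∈ Cube.boundary N, ∀ z' ∈ Cube.boundary N,
      (K.trans H.toHomotopy) (s, z) = (K.trans H.toHomotopy) (s, z') := by
    intro s z hz z' hz'
    simp only [ContinuousMap.Homotopy.trans_apply]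
    split_ifs
    · rw [hK _ z hz, hK _ z' hz']
    · change H _ = H _
      rw [H.eq_snd _ hz, H.eq_snd _ hz']; rfl
  have z0 : (fun _ => 0 : N → I) ∈ Cube.boundary N := ⟨Classical.arbitrary N, Or.inl rfl⟩
  exact GenLoop.homotopic_const_of_free (y := y) (K.trans H.toHomotopy) (map_continuous _)
    (ContinuousMap.Homotopy.apply_zero _) (ContinuousMap.Homotopy.apply_one _)
    (fun s => (K.trans H.toHomotopy) (s, fun _ => 0)) (by fun_prop)
    (fun s z hz => hb s z hz _ z0)

/-- Homotopy groups at two points joined by a path are isomorphic. -/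
theorem HomotopyGroup.nonempty_mulEquiv_of_joined [DecidableEq N] [Nonempty N] {x y : X}
    (h : Joined x y) : Nonempty (HomotopyGroup N X x ≃* HomotopyGroup N X y) := by
  obtain ⟨γ⟩ := h
  refine nonempty_mulEquiv_of_rel (fun a b => ∃ (f : Ω^ N X x) (g : Ω^ N X y),
    (⟦f⟧ : HomotopyGroup N X x) = a ∧ (⟦g⟧ : HomotopyGroup N X y) = b ∧
      GenLoop.FreelyHomotopic γ f g) ?_ ?_ ?_ ?_ ?_
  · rintro _ _ _ _ ⟨f, g, rfl, rfl, h⟩ ⟨f', g', rfl, rfl, h'⟩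
    have i := Classical.arbitrary N
    -- A product of classes is represented by the concatenation in the opposite order.
    exact ⟨_, _, (HomotopyGroup.mul_spec (i := i)).symm, (HomotopyGroup.mul_spec (i := i)).symm,
      h'.transAt i h⟩
  · rintro ⟨f⟩
    obtain ⟨g, hg⟩ := GenLoop.exists_freelyHomotopic γ f
    exact ⟨_, f, g, rfl, rfl, hg⟩
  · rintro ⟨g⟩
    obtain ⟨f, hf⟩ := GenLoop.exists_freelyHomotopic γ.symm g
    exact ⟨_, f, g, rfl, rfl, by simpa using hf.symm⟩
  · rintro _ ⟨f, g, hf, rfl, h⟩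
    exact Quotient.sound (h.symm.homotopic_const (Quotient.exact hf))
  · rintro _ ⟨f, g, rfl, hg, h⟩
    exact Quotient.sound (h.homotopic_const (Quotient.exact hg))

end Cube

end

noncomputable section

/-! ### Orthonormalisation by polar decomposition -/

section Polar

open scoped Matrix.Norms.L2Operator MatrixOrder ComplexOrder

open Matrix

variable {ι κ : Type*} [Fintype ι] [Fintype κ] [DecidableEq κ]

/-- The isometric factor of the polar decomposition of a matrix with independent columns. -/
def Matrix.polarPart (M : Matrix ι κ ℂ) : Matrix ι κ ℂ := M * (CFC.sqrt (Mᴴ * M))⁻¹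

theorem Matrix.det_gram_ne_zero {M : Matrix ι κ ℂ} (hM : ∀ v, M *ᵥ v = 0 → v = 0) :
    (Mᴴ * M).det ≠ 0 := by
  intro h
  obtain ⟨v, hv, h0⟩ := Matrix.exists_mulVec_eq_zero_iff.2 h
  exact hv (hM v ((Matrix.conjTranspose_mul_self_mulVec_eq_zero M v).1 h0))

theorem Matrix.mulVec_injective_of_gram_eq_one {M : Matrix ι κ ℂ} (hM : Mᴴ * M = 1) (v : κ → ℂ)
    (h : M *ᵥ v = 0) : v = 0 := by
  rw [← Matrix.one_mulVec v, ← hM, ← Matrix.mulVec_mulVec, h, Matrix.mulVec_zero]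

theorem Matrix.sqrt_gram_mul_self (M : Matrix ι κ ℂ) :
    CFC.sqrt (Mᴴ * M) * CFC.sqrt (Mᴴ * M) = Mᴴ * M :=
  CFC.sqrt_mul_sqrt_self _ (Matrix.posSemidef_conjTranspose_mul_self M).nonneg

theorem Matrix.det_sqrt_gram_ne_zero {M : Matrix ι κ ℂ} (hM : ∀ v, M *ᵥ v = 0 → v = 0) :
    (CFC.sqrt (Mᴴ * M)).det ≠ 0 := by
  have h := Matrix.det_gram_ne_zero hM
  rw [← Matrix.sqrt_gram_mul_self, Matrix.det_mul] at h
  exact left_ne_zero_of_mul h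

theorem Matrix.gram_polarPart {M : Matrix ι κ ℂ} (hM : ∀ v, M *ᵥ v = 0 → v = 0) :
    (Matrix.polarPart M)ᴴ * Matrix.polarPart M = 1 := by
  have hu : IsUnit (CFC.sqrt (Mᴴ * M)).det := (Matrix.det_sqrt_gram_ne_zero hM).isUnit
  have hs : (CFC.sqrt (Mᴴ * M))ᴴ = CFC.sqrt (Mᴴ * M) :=
    (CFC.sqrt_nonneg (Mᴴ * M)).isSelfAdjoint
  unfold Matrix.polarPart
  rw [Matrix.conjTranspose_mul, Matrix.conjTranspose_nonsing_inv, hs, Matrix.mul_assoc,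
    ← Matrix.mul_assoc Mᴴ]
  nth_rewrite 2 [← Matrix.sqrt_gram_mul_self]
  rw [Matrix.mul_assoc, Matrix.mul_nonsing_inv _ hu, Matrix.mul_one, Matrix.nonsing_inv_mul _ hu]

theorem Matrix.polarPart_of_gram_eq_one {M : Matrix ι κ ℂ} (hM : Mᴴ * M = 1) :
    Matrix.polarPart M = M := by
  simp [Matrix.polarPart, hM]

theorem Continuous.polarPart {K : Type*} [TopologicalSpace K] {M : K → Matrix ι κ ℂ}
    (hM : Continuous M) (h : ∀ k v, M k *ᵥ v = 0 → v = 0) :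
    Continuous fun k => Matrix.polarPart (M k) := by
  have h1 : Continuous fun k => (M k)ᴴ * M k := hM.matrix_conjTranspose.matrix_mul hM
  have h2 : Continuous fun k => CFC.sqrt ((M k)ᴴ * M k) :=
    CFC.continuousOn_sqrt.comp_continuous h1
      fun k => (Matrix.posSemidef_conjTranspose_mul_self (M k)).nonneg
  refine hM.matrix_mul ?_
  rw [continuous_iff_continuousAt]
  intro k
  refine ContinuousAt.comp (f := fun k => CFC.sqrt ((M k)ᴴ * M k)) (g := fun B => B⁻¹) ?_
    h2.continuousAt
  exact continuousAt_matrix_inv _ (by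
    rw [Ring.inverse_eq_inv']
    exact continuousAt_inv₀ (Matrix.det_sqrt_gram_ne_zero (h k)))

end Polar

/-! ### Lifting and extending finite-dimensional frames -/

section Transport

open scoped Matrix.Norms.L2Operator

open Matrix

variable {ι κ : Type} [Fintype ι] [Fintype κ] [DecidableEq ι] [DecidableEq κ]

/-- Currying turns `P` into a path in the normed space of maps on the compact space `K`; uniform
continuity of that path is uniform in `k`. -/
theorem exists_uniform_step {K : Type*} [TopologicalSpace K] [CompactSpace K]
    {P : K × I → Matrix ι ι ℂ} (hP : Continuous P) :
    ∃ N : ℕ, 0 < N ∧ ∀ k (s t : I), |(s : ℝ) - t| ≤ 1 / N → ‖P (k, s) - P (k, t)‖ < 1 := by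
  let F : C(I, C(K, Matrix ι ι ℂ)) := ContinuousMap.curry ⟨fun p => P (p.2, p.1), by fun_prop⟩
  have hF := CompactSpace.uniformContinuous_of_continuous F.continuous
  obtain ⟨ε, hε, h⟩ := Metric.uniformContinuous_iff.1 hF 1 one_pos
  obtain ⟨N, hN⟩ := exists_nat_one_div_lt hε
  refine ⟨N + 1, Nat.succ_pos _, fun k s t hst => ?_⟩
  have h1 : dist (F s) (F t) < 1 := h (by
    rw [Subtype.dist_eq, Real.dist_eq]
    refine hst.trans_lt ?_
    push_cast; exact hN)
  have h2 := (ContinuousMap.dist_apply_le_dist (f := F s) (g := F t) k).trans_lt h1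
  rwa [dist_eq_norm] at h2

/-- A frame transported along a path of projections by successive projections, at the times
`j / N`. -/
def transportAux {K : Type*} (P : K × I → Matrix ι ι ℂ) (A : K → Matrix ι κ ℂ) (N : ℕ) :
    ℕ → K × I → Matrix ι κ ℂ
  | 0, p => A p.1
  -- Each time is cut off at `p.2`: the frame stops moving on arrival at time `p.2`, which has
  -- happened after `N` steps.
  | j + 1, p => P (p.1, p.2 ⊓ Set.projIcc 0 1 zero_le_one (((j + 1 : ℕ) : ℝ) / N)) *
      transportAux P A N j p

/-- Orthonormal frames can be lifted along a homotopy of projections; the lift is stationary where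
the homotopy is. -/
theorem exists_frame_transport {K : Type*} [TopologicalSpace K] [CompactSpace K]
    {P : K × I → Matrix ι ι ℂ} (hP : Continuous P) (hPP : ∀ p, P p * P p = P p)
    {A : K → Matrix ι κ ℂ} (hA : Continuous A) (hAA : ∀ k, (A k)ᴴ * A k = 1)
    (hPA : ∀ k, P (k, 0) * A k = A k) :
    ∃ B : K × I → Matrix ι κ ℂ, Continuous B ∧ (∀ p, (B p)ᴴ * B p = 1) ∧
      (∀ p, P p * B p = B p) ∧ (∀ k, B (k, 0) = A k) ∧
      ∀ k, (∀ t, P (k, t) = P (k, 0)) → ∀ t, B (k, t) = A k := by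
  obtain ⟨N, hN, hstep⟩ := exists_uniform_step hP
  have hN' : (0 : ℝ) < N := by exact_mod_cast hN
  set M := transportAux P A N with hM
  have hcont : ∀ j, Continuous (M j) := by
    intro j
    induction j with
    | zero => exact hA.comp continuous_fst
    | succ j ih =>
      refine Continuous.matrix_mul (hP.comp ?_) ih
      exact continuous_fst.prodMk (continuous_snd.inf continuous_const)
  have hproj0 : Set.projIcc (0 : ℝ) 1 zero_le_one (((0 : ℕ) : ℝ) / N) = 0 := by
    simp [Set.projIcc_left]
  have hPM : ∀ (j : ℕ) p, P (p.1, p.2 ⊓ Set.projIcc 0 1 zero_le_one ((j : ℝ) / N)) * M j p = M j p := by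
    intro j p
    cases j with
    | zero =>
      rw [hproj0]
      have : p.2 ⊓ 0 = 0 := inf_eq_right.2 p.2.2.1
      rw [this]; exact hPA p.1
    | succ j => rw [hM, transportAux, ← Matrix.mul_assoc, hPP]
  -- Columns stay independent: `P s` fixes the current frame, so applying `P t` amounts to applying
  -- `1 - (P s - P t)`, which is invertible because the difference has norm less than `1`.
  have hinj : ∀ j p v, M j p *ᵥ v = 0 → v = 0 := by
    intro j
    induction j with
    | zero => exact fun p v hv => Matrix.mulVec_injective_of_gram_eq_one (hAA p.1) v hv
    | succ j ih =>
      intro p v hv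
      apply ih p v
      set s := p.2 ⊓ Set.projIcc 0 1 zero_le_one ((j : ℝ) / N) with hs
      set t := p.2 ⊓ Set.projIcc 0 1 zero_le_one (((j + 1 : ℕ) : ℝ) / N) with ht
      have hst : |(s : ℝ) - t| ≤ 1 / N := by
        have h1 : |(s : ℝ) - t| ≤ |max 0 (min 1 ((j : ℝ) / N)) -
            max 0 (min 1 (((j + 1 : ℕ) : ℝ) / N))| := by
          have := abs_min_sub_min_le_max (p.2 : ℝ) (max 0 (min 1 ((j : ℝ) / N))) (p.2 : ℝ)
            (max 0 (min 1 (((j + 1 : ℕ) : ℝ) / N)))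
          simp only [sub_self, abs_zero] at this
          exact this.trans (max_le (abs_nonneg _) le_rfl)
        refine h1.trans ?_
        have h2 := abs_max_sub_max_le_max (0 : ℝ) (min 1 ((j : ℝ) / N)) 0
          (min 1 (((j + 1 : ℕ) : ℝ) / N))
        have h3 := abs_min_sub_min_le_max (1 : ℝ) ((j : ℝ) / N) 1 (((j + 1 : ℕ) : ℝ) / N)
        simp only [sub_self, abs_zero] at h2 h3
        refine h2.trans (max_le (by positivity) (h3.trans (max_le (by positivity) (le_of_eq ?_))))
        rw [← sub_div, abs_div, abs_of_pos hN']
        push_cast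
        norm_num
      have hlt := hstep p.1 s t hst
      have hunit : IsUnit (1 - (P (p.1, s) - P (p.1, t))) := isUnit_one_sub_of_norm_lt_one hlt
      have hmul : (1 - (P (p.1, s) - P (p.1, t))) * M j p = M (j + 1) p := by
        rw [Matrix.sub_mul, Matrix.sub_mul, hPM j p, Matrix.one_mul, sub_sub_cancel]; rfl
      rw [← hmul, ← Matrix.mulVec_mulVec] at hv
      exact Matrix.mulVec_injective_of_isUnit hunit (by simpa using hv)
  have hstat : ∀ j k t, (∀ s ≤ t, P (k, s) = P (k, 0)) → M j (k, t) = A k := by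
    intro j k t h
    induction j with
    | zero => rfl
    | succ j ih => rw [hM, transportAux, ← hM, ih, h _ inf_le_left, hPA]
  have hlast : ∀ p, P p * M N p = M N p := by
    intro p
    have h := hPM N p
    rw [div_self hN'.ne', Set.projIcc_right] at h
    have : p.2 ⊓ (⟨1, Set.right_mem_Icc.2 zero_le_one⟩ : I) = p.2 := inf_eq_left.2 p.2.2.2
    rwa [this] at h
  -- The polar part multiplies on the right only, so it stays fixed by the projection, and it
  -- changes nothing where the columns are already orthonormal.
  refine ⟨fun p => Matrix.polarPart (M N p), (hcont N).polarPart (hinj N),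
    fun p => Matrix.gram_polarPart (hinj N p), fun p => ?_, fun k => ?_, fun k h t => ?_⟩
  · simp only [Matrix.polarPart]
    rw [← Matrix.mul_assoc, hlast]
  · dsimp only
    rw [hstat N k 0 (fun s hs => by rw [le_antisymm hs s.2.1]),
      Matrix.polarPart_of_gram_eq_one (hAA k)]
  · dsimp only
    rw [hstat N k t (fun s _ => h s), Matrix.polarPart_of_gram_eq_one (hAA k)]

/-- An orthonormal frame over a closed set extends after adding dimensions. -/
theorem exists_frame_extension {ι κ : Type} [Fintype ι] [Fintype κ] [DecidableEq κ] {K : Type*} [MetricSpace K] {C : Set K} (hC : IsClosed C)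
    (hne : C.Nonempty) {A : K → Matrix ι κ ℂ} (hA : ContinuousOn A C)
    (hAA : ∀ k ∈ C, (A k)ᴴ * A k = 1) :
    ∃ B : K → Matrix (ι ⊕ κ) κ ℂ, Continuous B ∧ (∀ k, (B k)ᴴ * B k = 1) ∧
      ∀ k ∈ C, B k = Matrix.fromRows (A k) 0 := by
  have := TietzeExtension.of_tvs ℂ (E := Matrix ι κ ℂ)
  obtain ⟨F, hF⟩ := ContinuousMap.exists_restrict_eq (Y := Matrix ι κ ℂ) hC
    ⟨C.domRestrict A, hA.domRestrict⟩
  have hFA : ∀ k ∈ C, F k = A k := fun k hk => congrArg (fun f => f ⟨k, hk⟩) hF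
  -- The lower block, the distance to `C` times the identity, keeps the columns independent off `C`
  -- whatever the Tietze extension does there, and vanishes on `C`.
  let M : K → Matrix (ι ⊕ κ) κ ℂ := fun k =>
    Matrix.fromRows (Matrix.of (F k)) ((Metric.infDist k C : ℂ) • (1 : Matrix κ κ ℂ))
  have hMC : ∀ k ∈ C, M k = Matrix.fromRows (A k) 0 := by
    intro k hk
    simp only [M, hFA k hk, Metric.infDist_zero_of_mem hk, Complex.ofReal_zero, zero_smul]
    rfl
  have hgram : ∀ k ∈ C, (M k)ᴴ * M k = 1 := by
    intro k hk
    rw [hMC k hk, Matrix.conjTranspose_fromRows_eq_fromCols_conjTranspose,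
      Matrix.fromCols_mul_fromRows, hAA k hk]
    simp
  have hM : Continuous M := by
    refine continuous_matrix fun i j => ?_
    cases i with
    | inl i => exact ((continuous_apply j).comp (continuous_apply i)).comp F.continuous
    | inr i =>
      change Continuous fun k => (Metric.infDist k C : ℂ) • (1 : Matrix κ κ ℂ) i j
      exact (Complex.continuous_ofReal.comp (Metric.continuous_infDist_pt C)).smul continuous_const
  have hinj : ∀ k v, M k *ᵥ v = 0 → v = 0 := by
    intro k v hv
    by_cases hk : k ∈ C
    · exact Matrix.mulVec_injective_of_gram_eq_one (hgram k hk) v hv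
    · have hd : (Metric.infDist k C : ℂ) ≠ 0 := by
        exact_mod_cast ((hC.notMem_iff_infDist_pos hne).1 hk).ne'
      have h2 : ((Metric.infDist k C : ℂ) • (1 : Matrix κ κ ℂ)) *ᵥ v = 0 := by
        funext i
        have := congrFun hv (Sum.inr i)
        rw [Matrix.fromRows_mulVec] at this
        simpa using this
      rw [Matrix.smul_mulVec, Matrix.one_mulVec] at h2
      exact (smul_eq_zero.1 h2).resolve_left hd
  refine ⟨fun k => Matrix.polarPart (M k), hM.polarPart hinj,
    fun k => Matrix.gram_polarPart (hinj k), fun k hk => ?_⟩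
  change Matrix.polarPart (M k) = _
  rw [Matrix.polarPart_of_gram_eq_one (hgram k hk), hMC k hk]

end Transport

/-! ### Path connectedness of the unitary group -/

section UnitaryConnected

open scoped Matrix.Norms.L2Operator

/-- The unitary group is path connected. -/
theorem joined_one_unitary {m : ℕ} (u : U m) : Joined 1 u := by
  have hfin : (spectrum ℂ (u : Matrix (Fin m) (Fin m) ℂ)).Finite := Matrix.finite_spectrum _
  -- The finite spectrum misses a point of the circle. Rotating `u` by a phase moves that point to
  -- `-1`, which puts the result at distance less than `2` from `1`, where it can be joined to `1`.
  have : ∃ θ : ℝ, -Complex.exp (-(θ * Complex.I)) ∉ spectrum ℂ (u : Matrix (Fin m) (Fin m) ℂ) := by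
    by_contra! hcon
    have hsub : (Metric.sphere (0 : ℂ) 1) ⊆ spectrum ℂ (u : Matrix (Fin m) (Fin m) ℂ) := by
      intro z hz
      obtain ⟨θ, hθ⟩ := (Complex.norm_eq_one_iff (-z)).1 (by simpa using hz)
      have := hcon (-θ)
      simp only [Complex.ofReal_neg, neg_mul, neg_neg] at this
      rwa [hθ, neg_neg] at this
    have hrank : 1 < Module.rank ℝ ℂ := by rw [Complex.rank_real_complex]; norm_num
    exact (isPreconnected_sphere hrank 0 1).infinite_of_nontrivial
      ⟨1, by simp, -1, by simp, by norm_num⟩ (hfin.subset hsub)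
  obtain ⟨θ, hθ⟩ := this
  let w : I → U m := fun s => ⟨Complex.exp (s * θ * Complex.I) • (u : Matrix (Fin m) (Fin m) ℂ), by
    rw [Unitary.mem_iff]
    have h1 : star (Complex.exp (s * θ * Complex.I)) * Complex.exp (s * θ * Complex.I) = 1 := by
      rw [Complex.star_def, ← Complex.exp_conj, ← Complex.exp_add]
      simp
    have h2 := u.2
    rw [Unitary.mem_iff] at h2
    constructor
    · rw [star_smul, smul_mul_smul_comm, h1, h2.1, one_smul]
    · rw [star_smul, smul_mul_smul_comm, mul_comm, h1, h2.2, one_smul]⟩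
  have hw : Continuous w := by
    refine Continuous.subtype_mk ?_ _
    fun_prop
  have hw0 : w 0 = u := Subtype.ext (by simp [w])
  have hnorm : ‖((w 1 : U m) : Matrix (Fin m) (Fin m) ℂ) - 1‖ < 2 := by
    rw [Unitary.norm_sub_one_lt_two_iff (w 1).2]
    intro hmem
    apply hθ
    have hne := Complex.exp_ne_zero (θ * Complex.I)
    have : (w 1 : Matrix (Fin m) (Fin m) ℂ) = (Units.mk0 _ hne) • (u : Matrix (Fin m) (Fin m) ℂ) := by
      simp [w]
    rw [this, spectrum.unit_smul_eq_smul, Set.mem_smul_set_iff_inv_smul_mem] at hmem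
    have e : (Units.mk0 _ hne)⁻¹ • (-1 : ℂ) = -Complex.exp (-(θ * Complex.I)) := by
      rw [Units.smul_def]
      simp [Complex.exp_neg]
    rwa [e] at hmem
  have h1 : Joined (1 : U m) (w 1) := Unitary.joined 1 (w 1) hnorm
  exact h1.trans (Joined.symm ⟨⟨⟨w, hw⟩, hw0, rfl⟩⟩)

end UnitaryConnected
end

noncomputable section

open Matrix

/-! ### Points of `χ_m(ℂⁿ)` in terms of frames and matrices -/

section FiniteStage

variable {m n : ℕ}

theorem Matrix.toEuclideanLin_mul {ι κ l : Type*} [Fintype ι] [Fintype κ] [Fintype l]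
    [DecidableEq κ] [DecidableEq l] (A : Matrix ι κ ℂ) (B : Matrix κ l ℂ) :
    Matrix.toEuclideanLin (A * B) = Matrix.toEuclideanLin A ∘ₗ Matrix.toEuclideanLin B := by
  ext1 v
  simp

theorem Matrix.toEuclideanLin_injective_of_gram {M : Matrix (Fin n) (Fin m) ℂ} (hM : Mᴴ * M = 1) :
    Function.Injective (Matrix.toEuclideanLin M) := by
  intro v w h
  have : Matrix.toEuclideanLin (Mᴴ * M) v = Matrix.toEuclideanLin (Mᴴ * M) w := by
    rw [Matrix.toEuclideanLin_mul, LinearMap.comp_apply, LinearMap.comp_apply, h]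
  simpa [hM, Matrix.toLpLin_apply] using this

theorem Matrix.mem_orthogonal_range_toEuclideanLin {M : Matrix (Fin n) (Fin m) ℂ}
    {v : EuclideanSpace ℂ (Fin n)} :
    v ∈ (LinearMap.range (Matrix.toEuclideanLin M))ᗮ ↔ Matrix.toEuclideanLin Mᴴ v = 0 := by
  rw [LinearMap.orthogonal_range, LinearMap.mem_ker, Matrix.toEuclideanLin_conjTranspose_eq_adjoint]

theorem Matrix.starProjection_range {M : Matrix (Fin n) (Fin m) ℂ} (hM : Mᴴ * M = 1) :
    (LinearMap.range (Matrix.toEuclideanLin M)).starProjection =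
      Matrix.toEuclideanCLM (n := Fin n) (𝕜 := ℂ) (M * Mᴴ) := by
  ext1 v
  have h : Matrix.toEuclideanCLM (n := Fin n) (𝕜 := ℂ) (M * Mᴴ) v =
      Matrix.toEuclideanLin M (Matrix.toEuclideanLin Mᴴ v) := by
    rw [← LinearMap.comp_apply, ← Matrix.toEuclideanLin_mul]; rfl
  rw [h]
  refine Submodule.eq_starProjection_of_mem_orthogonal (LinearMap.mem_range_self _ _) ?_
  have h' : ∀ w, Matrix.toEuclideanLin Mᴴ (Matrix.toEuclideanLin M w) = w := fun w => by
    rw [← LinearMap.comp_apply, ← Matrix.toEuclideanLin_mul, hM]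
    simp
  rw [Matrix.mem_orthogonal_range_toEuclideanLin, map_sub, h', sub_self]

/-- The unitary of `ℂⁿ` acting as `g` on the span of the frame `M` and trivially on its orthogonal
complement. -/
def frameUnitary (M : Matrix (Fin n) (Fin m) ℂ) (g : Matrix (Fin m) (Fin m) ℂ) :
    Matrix (Fin n) (Fin n) ℂ := M * g * Mᴴ + (1 - M * Mᴴ)

theorem frameUnitary_mul {M : Matrix (Fin n) (Fin m) ℂ} (hM : Mᴴ * M = 1)
    (g h : Matrix (Fin m) (Fin m) ℂ) :
    frameUnitary M g * frameUnitary M h = frameUnitary M (g * h) := by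
  have e : ∀ X : Matrix (Fin m) (Fin n) ℂ, Mᴴ * (M * X) = X := fun X => by
    rw [← Matrix.mul_assoc, hM, Matrix.one_mul]
  simp only [frameUnitary, Matrix.add_mul, Matrix.mul_add, Matrix.sub_mul, Matrix.mul_sub,
    Matrix.mul_assoc, e, Matrix.one_mul, Matrix.mul_one, sub_self]
  abel

theorem frameUnitary_one (M : Matrix (Fin n) (Fin m) ℂ) : frameUnitary M 1 = 1 := by
  simp [frameUnitary]

theorem star_frameUnitary (M : Matrix (Fin n) (Fin m) ℂ) (g : Matrix (Fin m) (Fin m) ℂ) :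
    star (frameUnitary M g) = frameUnitary M (star g) := by
  simp [frameUnitary, Matrix.star_eq_conjTranspose, Matrix.mul_assoc]

theorem frameUnitary_mem {M : Matrix (Fin n) (Fin m) ℂ} (hM : Mᴴ * M = 1) (g : U m) :
    frameUnitary M g.1 ∈ Matrix.unitaryGroup (Fin n) ℂ := by
  rw [Matrix.mem_unitaryGroup_iff, star_frameUnitary, frameUnitary_mul hM,
    Matrix.mem_unitaryGroup_iff.1 g.2, frameUnitary_one]

theorem frameUnitary_mul_frame {M : Matrix (Fin n) (Fin m) ℂ} (hM : Mᴴ * M = 1)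
    (g : Matrix (Fin m) (Fin m) ℂ) : frameUnitary M g * M = M * g := by
  simp [frameUnitary, Matrix.add_mul, Matrix.sub_mul, Matrix.mul_assoc, hM]

/-- The point of `χ_m(ℂⁿ)` given by an orthonormal frame and a unitary matrix in that frame. -/
def chiOf (M : Matrix (Fin n) (Fin m) ℂ) (hM : Mᴴ * M = 1) (g : U m) : Chi m n :=
  ⟨(⟨LinearMap.range (Matrix.toEuclideanLin M), by
      rw [LinearMap.finrank_range_of_inj (Matrix.toEuclideanLin_injective_of_gram hM)]; simp⟩,
    ⟨frameUnitary M g.1, frameUnitary_mem hM g⟩), by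
    refine ⟨?_, fun v hv => ?_⟩
    · change (LinearMap.range (Matrix.toEuclideanLin M)).map
        (Matrix.toEuclideanLin (frameUnitary M g.1)) = LinearMap.range (Matrix.toEuclideanLin M)
      rw [← LinearMap.range_comp, ← Matrix.toEuclideanLin_mul, frameUnitary_mul_frame hM,
        Matrix.toEuclideanLin_mul, LinearMap.range_comp_of_range_eq_top]
      rw [LinearMap.range_eq_top]
      intro v
      refine ⟨Matrix.toEuclideanLin (star g.1) v, ?_⟩
      rw [← LinearMap.comp_apply, ← Matrix.toEuclideanLin_mul, Matrix.mem_unitaryGroup_iff.1 g.2]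
      simp
    · have h0 : Matrix.toEuclideanLin Mᴴ v = 0 := Matrix.mem_orthogonal_range_toEuclideanLin.1 hv
      change Matrix.toEuclideanLin (frameUnitary M g.1) v = v
      rw [frameUnitary, map_add, map_sub, Matrix.toEuclideanLin_mul, Matrix.toEuclideanLin_mul M Mᴴ,
        LinearMap.add_apply, LinearMap.sub_apply, LinearMap.comp_apply, LinearMap.comp_apply, h0]
      simp⟩

/-- The matrix of the orthogonal projection onto the subspace of a point of `χ_m(ℂⁿ)`. -/
def Chi.proj (p : Chi m n) : Matrix (Fin n) (Fin n) ℂ :=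
  (Matrix.toEuclideanCLM (n := Fin n) (𝕜 := ℂ)).symm p.1.1.1.starProjection

theorem Chi.toEuclideanCLM_proj (p : Chi m n) :
    Matrix.toEuclideanCLM (n := Fin n) (𝕜 := ℂ) p.proj = p.1.1.1.starProjection := by
  simp [Chi.proj]

theorem Chi.toEuclideanLin_proj (p : Chi m n) (v : EuclideanSpace ℂ (Fin n)) :
    Matrix.toEuclideanLin p.proj v = p.1.1.1.starProjection v := by
  rw [← p.toEuclideanCLM_proj]; rfl

theorem chiOf_proj {M : Matrix (Fin n) (Fin m) ℂ} (hM : Mᴴ * M = 1) (g : U m) :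
    (chiOf M hM g).proj = M * Mᴴ := by
  rw [Chi.proj, StarAlgEquiv.symm_apply_eq]
  exact Matrix.starProjection_range hM

theorem Chi.ext_proj {p q : Chi m n} (h : p.proj = q.proj) (hu : p.1.2.1 = q.1.2.1) : p = q := by
  have h1 : p.1.1.1.starProjection = q.1.1.1.starProjection := by
    rw [← p.toEuclideanCLM_proj, ← q.toEuclideanCLM_proj, h]
  have h2 : p.1.1.1 = q.1.1.1 := by
    rw [← Submodule.range_starProjection p.1.1.1, h1, Submodule.range_starProjection]
  exact Subtype.ext (Prod.ext (Subtype.ext h2) (Subtype.ext hu))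

/-- Continuity into `χ_m(ℂⁿ)` can thereby be tested on two matrices, the projection and the unitary.
-/
theorem Chi.isInducing :
    Topology.IsInducing fun p : Chi m n => (p.proj, (p.1.2.1 : Matrix (Fin n) (Fin n) ℂ)) := by
  let e : Matrix (Fin n) (Fin n) ℂ ≃ₗ[ℂ]
      (EuclideanSpace ℂ (Fin n) →L[ℂ] EuclideanSpace ℂ (Fin n)) :=
    (Matrix.toEuclideanCLM (n := Fin n) (𝕜 := ℂ)).toAlgEquiv.toLinearEquiv
  have h1 : Topology.IsInducing e.symm := e.toContinuousLinearEquiv.symm.toHomeomorph.isInducing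
  have h2 : Topology.IsInducing fun S : Grass m n => S.1.starProjection := ⟨rfl⟩
  exact ((h1.comp h2).prodMap Topology.IsInducing.subtypeVal).comp Topology.IsInducing.subtypeVal

theorem Chi.exists_frame (p : Chi m n) :
    ∃ (M : Matrix (Fin n) (Fin m) ℂ) (_ : Mᴴ * M = 1), M * Mᴴ = p.proj := by
  let b := (stdOrthonormalBasis ℂ p.1.1.1).reindex (finCongr p.1.1.2)
  let M : Matrix (Fin n) (Fin m) ℂ := Matrix.of fun i j => (b j).1 i
  have hM : Mᴴ * M = 1 := by
    ext j k
    have h := orthonormal_iff_ite.1 b.orthonormal j k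
    rw [Matrix.one_apply, ← h, Matrix.mul_apply, Submodule.coe_inner, PiLp.inner_apply]
    refine Finset.sum_congr rfl fun i _ => ?_
    simp [M, mul_comm]
  refine ⟨M, hM, ?_⟩
  have hr : LinearMap.range (Matrix.toEuclideanLin M) = p.1.1.1 := by
    refine Submodule.eq_of_le_of_finrank_eq ?_ ?_
    · rintro _ ⟨v, rfl⟩
      have : Matrix.toEuclideanLin M v = ∑ j, v j • (b j).1 := by
        ext i
        simp [M, Matrix.toLpLin_apply, Matrix.mulVec, dotProduct, mul_comm]
      rw [this]
      exact Submodule.sum_mem _ fun j _ => Submodule.smul_mem _ _ (b j).2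
    · rw [LinearMap.finrank_range_of_inj (Matrix.toEuclideanLin_injective_of_gram hM), p.1.1.2]
      simp
  have hS : ∀ S : Submodule ℂ (EuclideanSpace ℂ (Fin n)),
      LinearMap.range (Matrix.toEuclideanLin M) = S →
        S.starProjection = Matrix.toEuclideanCLM (n := Fin n) (𝕜 := ℂ) (M * Mᴴ) := by
    rintro _ rfl
    exact Matrix.starProjection_range hM
  rw [Chi.proj, hS _ hr, StarAlgEquiv.symm_apply_apply]

theorem Chi.mul_one_sub_proj (p : Chi m n) : p.1.2.1 * (1 - p.proj) = 1 - p.proj := by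
  apply (Matrix.toEuclideanLin (𝕜 := ℂ)).injective
  ext1 v
  rw [Matrix.toEuclideanLin_mul, LinearMap.comp_apply]
  refine p.2.2 _ ?_
  rw [map_sub, LinearMap.sub_apply, p.toEuclideanLin_proj]
  have : Matrix.toEuclideanLin (1 : Matrix (Fin n) (Fin n) ℂ) v = v := by
    simp
  rw [this]
  exact Submodule.sub_starProjection_mem_orthogonal v

theorem Chi.proj_mul_mul_proj (p : Chi m n) : p.proj * (p.1.2.1 * p.proj) = p.1.2.1 * p.proj := by
  apply (Matrix.toEuclideanLin (𝕜 := ℂ)).injective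
  ext1 v
  rw [Matrix.toEuclideanLin_mul, LinearMap.comp_apply, p.toEuclideanLin_proj,
    Submodule.starProjection_eq_self_iff, Matrix.toEuclideanLin_mul, LinearMap.comp_apply,
    p.toEuclideanLin_proj]
  have h := p.2.1
  rw [← h]
  exact Submodule.mem_map_of_mem (h.symm ▸ Submodule.starProjection_apply_mem _ v)

/-- With `P` the projection and `u` the unitary, the two defining conditions say `u = P * u * P + (1
- P)`, so `u` is recovered from its compression to the frame. The explicit formula for `g` makes it
continuous in the point and the frame. -/
theorem Chi.exists_eq_chiOf (p : Chi m n) {M : Matrix (Fin n) (Fin m) ℂ} (hM : Mᴴ * M = 1)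
    (h : M * Mᴴ = p.proj) : ∃ g : U m, g.1 = Mᴴ * p.1.2.1 * M ∧ p = chiOf M hM g := by
  have hPM : p.proj * M = M := by rw [← h, Matrix.mul_assoc, hM, Matrix.mul_one]
  have hMP : Mᴴ * p.proj = Mᴴ := by rw [← h, ← Matrix.mul_assoc, hM, Matrix.one_mul]
  have hu := Matrix.mem_unitaryGroup_iff'.1 p.1.2.2
  have h1 := p.mul_one_sub_proj
  have h2 := p.proj_mul_mul_proj
  generalize hP : p.proj = P at *
  generalize hU : p.1.2.1 = u at *
  have h3 : P * (u * M) = u * M := by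
    nth_rewrite 1 [← hPM]
    rw [← Matrix.mul_assoc u, ← Matrix.mul_assoc P, h2, Matrix.mul_assoc, hPM]
  have hg : Mᴴ * u * M ∈ Matrix.unitaryGroup (Fin m) ℂ := by
    rw [Matrix.mem_unitaryGroup_iff', Matrix.star_eq_conjTranspose]
    simp only [Matrix.conjTranspose_mul, Matrix.conjTranspose_conjTranspose, Matrix.mul_assoc]
    rw [← Matrix.mul_assoc M, h, h3, ← Matrix.mul_assoc uᴴ, ← Matrix.star_eq_conjTranspose u, hu,
      Matrix.one_mul, hM]
  refine ⟨⟨_, hg⟩, rfl, Chi.ext_proj ?_ ?_⟩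
  · rw [chiOf_proj, hP, h]
  · change p.1.2.1 = M * (Mᴴ * u * M) * Mᴴ + (1 - M * Mᴴ)
    have : M * (Mᴴ * u * M) * Mᴴ = P * (u * P) := by
      rw [← h]; simp only [Matrix.mul_assoc]
    rw [this, h, h2, hU, ← h1, Matrix.mul_sub, Matrix.mul_one]
    abel

end FiniteStage
end

noncomputable section

open Matrix

/-! ### Frames in `ℂ^∞` and the points they give -/

section InfiniteFrames

variable {m : ℕ}

/-- The first `n` rows of a matrix with rows indexed by `ℕ`. -/
def Matrix.topRows (n : ℕ) (A : Matrix ℕ (Fin m) ℂ) : Matrix (Fin n) (Fin m) ℂ := fun i j => A i j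

/-- Extension of a matrix by zero rows. -/
def Matrix.padRows {n : ℕ} (M : Matrix (Fin n) (Fin m) ℂ) : Matrix ℕ (Fin m) ℂ := fun i j =>
  if h : i < n then M ⟨i, h⟩ j else 0

/-- The columns of `A` are an orthonormal family in `ℂⁿ ⊆ ℂ^∞`. -/
def IsFrame (n : ℕ) (A : Matrix ℕ (Fin m) ℂ) : Prop :=
  (∀ i j, n ≤ i → A i j = 0) ∧ (A.topRows n)ᴴ * A.topRows n = 1

theorem Matrix.topRows_padRows {n : ℕ} (M : Matrix (Fin n) (Fin m) ℂ) : M.padRows.topRows n = M := by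
  ext i j; simp [Matrix.topRows, Matrix.padRows]

theorem Matrix.topRows_mul (n : ℕ) (A : Matrix ℕ (Fin m) ℂ) (C : Matrix (Fin m) (Fin m) ℂ) :
    (A * C).topRows n = A.topRows n * C := rfl

theorem isFrame_padRows {n : ℕ} {M : Matrix (Fin n) (Fin m) ℂ} (hM : Mᴴ * M = 1) :
    IsFrame n M.padRows :=
  ⟨fun i j h => dif_neg (not_lt.2 h), by rwa [Matrix.topRows_padRows]⟩

theorem IsFrame.mono {n n' : ℕ} (h : n ≤ n') {A : Matrix ℕ (Fin m) ℂ} (hA : IsFrame n A) :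
    IsFrame n' A := by
  refine ⟨fun i j hi => hA.1 i j (h.trans hi), ?_⟩
  rw [← hA.2]
  ext j k
  simp only [Matrix.mul_apply, Matrix.conjTranspose_apply, Matrix.topRows]
  rw [Fin.sum_univ_eq_sum_range (fun i => star (A i j) * A i k),
    Fin.sum_univ_eq_sum_range (fun i => star (A i j) * A i k)]
  refine (Finset.sum_subset (Finset.range_mono h) fun i _ hi => ?_).symm
  rw [hA.1 i k (by simpa using hi), mul_zero]

theorem IsFrame.mul_unitary {n : ℕ} {A : Matrix ℕ (Fin m) ℂ} (hA : IsFrame n A) (C : U m) :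
    IsFrame n (A * C.1) := by
  refine ⟨fun i j hi => ?_, ?_⟩
  · rw [Matrix.mul_apply]
    exact Finset.sum_eq_zero fun k _ => by rw [hA.1 i k hi, zero_mul]
  · rw [Matrix.topRows_mul, Matrix.conjTranspose_mul, Matrix.mul_assoc,
      ← Matrix.mul_assoc _ _ C.1, hA.2, Matrix.one_mul]
    exact Matrix.mem_unitaryGroup_iff'.1 C.2

theorem padVec_apply {n : ℕ} (v : EuclideanSpace ℂ (Fin n)) (i : ℕ) :
    padVec n v i = if h : i < n then v ⟨i, h⟩ else 0 := by
  have e : padVec n v = Finsupp.mapDomain Fin.val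
      ((Finsupp.linearEquivFunOnFinite ℂ ℂ (Fin n)).symm v.ofLp) := rfl
  rw [e]
  split_ifs with h
  · have := Finsupp.mapDomain_apply Fin.val_injective
      ((Finsupp.linearEquivFunOnFinite ℂ ℂ (Fin n)).symm v.ofLp) ⟨i, h⟩
    rw [this]; rfl
  · refine Finsupp.mapDomain_of_notMem_range _ _ ?_
    rintro ⟨j, rfl⟩
    exact h j.2

theorem padVec_topRows {n : ℕ} {A : Matrix ℕ (Fin m) ℂ} (hA : ∀ i j, n ≤ i → A i j = 0)
    (v : EuclideanSpace ℂ (Fin m)) :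
    ⇑(padVec n (Matrix.toEuclideanLin (A.topRows n) v)) = A *ᵥ v.ofLp := by
  ext i
  rw [padVec_apply]
  split_ifs with h
  · rfl
  · simp [Matrix.mulVec, dotProduct, hA i _ (not_lt.1 h)]

theorem padMat_frameUnitary {n : ℕ} {A : Matrix ℕ (Fin m) ℂ} (hA : ∀ i j, n ≤ i → A i j = 0)
    (g : Matrix (Fin m) (Fin m) ℂ) :
    padMat (frameUnitary (A.topRows n) g) = A * g * Aᴴ + (1 - A * Aᴴ) := by
  ext i j
  unfold padMat
  split_ifs with h hij
  · simp only [frameUnitary, Matrix.add_apply, Matrix.sub_apply, Matrix.one_apply, Fin.mk.injEq]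
    rfl
  · subst hij
    have hi : n ≤ i := by simpa using h
    simp [Matrix.mul_apply, hA i _ hi]
  · have h0 : ∀ B : Matrix (Fin m) (Fin m) ℂ, (A * B * Aᴴ) i j = 0 := by
      intro B
      rw [not_and_or, not_lt, not_lt] at h
      rcases h with h | h
      · rw [Matrix.mul_assoc, Matrix.mul_apply]
        exact Finset.sum_eq_zero fun k _ => by rw [hA i k h, zero_mul]
      · rw [Matrix.mul_apply]
        exact Finset.sum_eq_zero fun k _ => by
          rw [Matrix.conjTranspose_apply, hA j k h, star_zero, mul_zero]
    have h1 := h0 1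
    rw [Matrix.mul_one] at h1
    simp [h0, h1, hij]

/-- The standard frame of `ℂ^m ⊆ ℂ^∞`. -/
def stdFrame (m : ℕ) : Matrix ℕ (Fin m) ℂ := (1 : Matrix (Fin m) (Fin m) ℂ).padRows

theorem isFrame_stdFrame (m : ℕ) : IsFrame m (stdFrame m) := isFrame_padRows (by simp)

theorem topRows_stdFrame_mul (C : Matrix (Fin m) (Fin m) ℂ) :
    (stdFrame m * C).topRows m = C := by
  rw [Matrix.topRows_mul, stdFrame, Matrix.topRows_padRows, Matrix.one_mul]

/-- Neither this description nor `incl_chiOf_snd` depends on `n` on the right-hand side, so the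
point depends only on `A` and `g`. -/
theorem incl_chiOf_fst {n : ℕ} {A : Matrix ℕ (Fin m) ℂ} (hA : IsFrame n A) (g : U m)
    (x : ℕ →₀ ℂ) :
    x ∈ (BChi.incl m n (chiOf (A.topRows n) hA.2 g)).1.1 ↔ ∃ v : Fin m → ℂ, ⇑x = A *ᵥ v := by
  change x ∈ (LinearMap.range (Matrix.toEuclideanLin (A.topRows n))).map (padVec n) ↔ _
  rw [← LinearMap.range_comp, LinearMap.mem_range]
  constructor
  · rintro ⟨v, rfl⟩
    exact ⟨v.ofLp, padVec_topRows hA.1 v⟩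
  · rintro ⟨v, hv⟩
    exact ⟨WithLp.toLp 2 v, DFunLike.coe_injective ((padVec_topRows hA.1 _).trans hv.symm)⟩

theorem incl_chiOf_snd {n : ℕ} {A : Matrix ℕ (Fin m) ℂ} (hA : IsFrame n A) (g : U m) :
    (BChi.incl m n (chiOf (A.topRows n) hA.2 g)).1.2 = A * g.1 * Aᴴ + (1 - A * Aᴴ) :=
  padMat_frameUnitary hA.1 g.1

theorem incl_chiOf_eq {n n' : ℕ} {A : Matrix ℕ (Fin m) ℂ} (hA : IsFrame n A) (hA' : IsFrame n' A)
    (g : U m) : BChi.incl m n (chiOf (A.topRows n) hA.2 g) =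
      BChi.incl m n' (chiOf (A.topRows n') hA'.2 g) := by
  refine Subtype.ext (Prod.ext ?_ ?_)
  · ext x; rw [incl_chiOf_fst hA, incl_chiOf_fst hA']
  · rw [incl_chiOf_snd hA, incl_chiOf_snd hA']

/-- The point of the classifying space given by a frame in `ℂ^∞` and a unitary matrix acting in that
frame; for matrices which are not frames the standard frame is used. -/
def BChi.ofFrame (A : Matrix ℕ (Fin m) ℂ) (g : U m) : BChi m :=
  open Classical in
  if h : ∃ n, IsFrame n A then BChi.incl m _ (chiOf _ h.choose_spec.2 g)
  else BChi.incl m _ (chiOf _ (isFrame_stdFrame m).2 g)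

theorem BChi.ofFrame_eq {n : ℕ} {A : Matrix ℕ (Fin m) ℂ} (hA : IsFrame n A) (g : U m) :
    BChi.ofFrame A g = BChi.incl m n (chiOf (A.topRows n) hA.2 g) := by
  have h : ∃ n, IsFrame n A := ⟨n, hA⟩
  rw [BChi.ofFrame, dif_pos h]
  exact incl_chiOf_eq h.choose_spec hA g

theorem BChi.exists_ofFrame_incl {n : ℕ} (p : Chi m n) : ∃ (A : Matrix ℕ (Fin m) ℂ) (g : U m)
    (_ : IsFrame n A), BChi.incl m n p = BChi.ofFrame A g ∧ A.topRows n * (A.topRows n)ᴴ = p.proj := by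
  obtain ⟨M, hM, h⟩ := p.exists_frame
  obtain ⟨g, -, hg⟩ := p.exists_eq_chiOf hM h
  refine ⟨M.padRows, g, isFrame_padRows hM, ?_, by rw [Matrix.topRows_padRows, h]⟩
  rw [BChi.ofFrame_eq (isFrame_padRows hM), hg]
  simp only [Matrix.topRows_padRows]

theorem BChi.exists_ofFrame (x : BChi m) :
    ∃ n, ∃ (A : Matrix ℕ (Fin m) ℂ) (g : U m), IsFrame n A ∧ x = BChi.ofFrame A g := by
  obtain ⟨x, n, p, rfl⟩ := x
  obtain ⟨A, g, hA, h, -⟩ := BChi.exists_ofFrame_incl p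
  exact ⟨n, A, g, hA, h⟩

theorem BChi.ofFrame_mul {n : ℕ} {A : Matrix ℕ (Fin m) ℂ} (hA : IsFrame n A) (C g : U m) :
    BChi.ofFrame (A * C.1) g = BChi.ofFrame A (C * g * C⁻¹) := by
  rw [BChi.ofFrame_eq hA, BChi.ofFrame_eq (hA.mul_unitary C)]
  have hC : C.1 * C.1ᴴ = 1 := Matrix.mem_unitaryGroup_iff.1 C.2
  refine Subtype.ext (Prod.ext ?_ ?_)
  · ext x
    rw [incl_chiOf_fst (hA.mul_unitary C), incl_chiOf_fst hA]
    constructor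
    · rintro ⟨v, h⟩
      exact ⟨C.1 *ᵥ v, by rw [h, Matrix.mulVec_mulVec]⟩
    · rintro ⟨v, h⟩
      refine ⟨C.1ᴴ *ᵥ v, ?_⟩
      rw [h, Matrix.mulVec_mulVec, Matrix.mul_assoc, hC, Matrix.mul_one]
  · rw [incl_chiOf_snd (hA.mul_unitary C), incl_chiOf_snd hA]
    have e : (C * g * C⁻¹ : U m).1 = C.1 * g.1 * C.1ᴴ := rfl
    rw [e]
    have e1 : A * C.1 * (A * C.1)ᴴ = A * Aᴴ := by
      rw [Matrix.conjTranspose_mul, Matrix.mul_assoc, ← Matrix.mul_assoc C.1, hC, Matrix.one_mul]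
    rw [e1]
    simp only [Matrix.conjTranspose_mul, Matrix.mul_assoc]

/-- In a common stage the columns of `B` are combinations of those of `A`; the coefficient matrix is
unitary because both families are orthonormal. -/
theorem BChi.ofFrame_fst_eq {n n' : ℕ} {A B : Matrix ℕ (Fin m) ℂ} (hA : IsFrame n A)
    (hB : IsFrame n' B) {g h : U m} (e : (BChi.ofFrame A g).1.1 = (BChi.ofFrame B h).1.1) :
    ∃ C : U m, B = A * C.1 := by
  have hA' := hA.mono (le_max_left n n')
  have hB' := hB.mono (le_max_right n n')
  set N := max n n'
  rw [BChi.ofFrame_eq hA', BChi.ofFrame_eq hB'] at e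
  have hcol : ∀ j, ∃ v : Fin m → ℂ, (fun i => B i j) = A *ᵥ v := by
    intro j
    have h1 := padVec_topRows hB'.1 (WithLp.toLp 2 (Pi.single j (1 : ℂ)))
    have h2 := (incl_chiOf_fst hB' h _).2 ⟨_, h1⟩
    rw [← e, incl_chiOf_fst hA'] at h2
    obtain ⟨v, hv⟩ := h2
    refine ⟨v, ?_⟩
    rw [← hv, h1]
    ext i; simp
  choose v hv using hcol
  let C : Matrix (Fin m) (Fin m) ℂ := fun i j => v j i
  have hBC : B = A * C := by
    ext i j
    exact congrFun (hv j) i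
  refine ⟨⟨C, ?_⟩, hBC⟩
  rw [Matrix.mem_unitaryGroup_iff', Matrix.star_eq_conjTranspose]
  have h1 := hB'.2
  rwa [hBC, Matrix.topRows_mul, Matrix.conjTranspose_mul, Matrix.mul_assoc,
    ← Matrix.mul_assoc _ _ C, hA'.2, Matrix.one_mul] at h1

theorem BChi.ofFrame_right_injective {n : ℕ} {A : Matrix ℕ (Fin m) ℂ} (hA : IsFrame n A)
    {g h : U m} (e : BChi.ofFrame A g = BChi.ofFrame A h) : g = h := by
  have e2 := congrArg (fun x => x.1.2) e
  simp only [BChi.ofFrame_eq hA, incl_chiOf_snd hA, add_left_inj] at e2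
  have e3 : A.topRows n * g.1 * (A.topRows n)ᴴ = A.topRows n * h.1 * (A.topRows n)ᴴ := by
    ext i j
    exact congrFun (congrFun e2 i) j
  have e4 := congrArg (fun X => (A.topRows n)ᴴ * X * A.topRows n) e3
  simp only [Matrix.mul_assoc, hA.2, Matrix.mul_one] at e4
  rw [← Matrix.mul_assoc, ← Matrix.mul_assoc, hA.2, Matrix.one_mul, Matrix.one_mul] at e4
  exact Subtype.ext e4

/-- A frame over the base point is a rotation of the standard frame. -/
theorem BChi.ofFrame_eq_std {n : ℕ} {A : Matrix ℕ (Fin m) ℂ} (hA : IsFrame n A) {g : U m}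
    (e : BChi.ofFrame A g = BChi.ofFrame (stdFrame m) 1) :
    g = 1 ∧ A.topRows m ∈ Matrix.unitaryGroup (Fin m) ℂ ∧ A = stdFrame m * A.topRows m := by
  obtain ⟨C, hC⟩ := BChi.ofFrame_fst_eq (isFrame_stdFrame m) hA (congrArg (fun x => x.1.1) e.symm)
  have ht : A.topRows m = C.1 := by rw [hC, topRows_stdFrame_mul]
  refine ⟨?_, ht ▸ C.2, by rw [ht]; exact hC⟩
  rw [hC, BChi.ofFrame_mul (isFrame_stdFrame m)] at e
  have := BChi.ofFrame_right_injective (isFrame_stdFrame m) e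
  simpa [mul_inv_eq_one] using this

/-- Conjugation fixes the identity, so a rotation of the frame is invisible over the base point. -/
theorem BChi.ofFrame_std_mul (C : U m) :
    BChi.ofFrame (stdFrame m * C.1) 1 = BChi.ofFrame (stdFrame m) 1 := by
  rw [BChi.ofFrame_mul (isFrame_stdFrame m)]; simp

/-! ### The direct limit topology: embeddings of the stages and compact sets -/

/-- The infinite matrix of the orthogonal projection onto the subspace of a point of the
classifying space. -/
def BChi.proj (x : BChi m) : Matrix ℕ ℕ ℂ :=
  x.exists_ofFrame.choose_spec.choose * x.exists_ofFrame.choose_spec.chooseᴴ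

theorem BChi.proj_ofFrame {n : ℕ} {A : Matrix ℕ (Fin m) ℂ} (hA : IsFrame n A) (g : U m) :
    (BChi.ofFrame A g).proj = A * Aᴴ := by
  set x := BChi.ofFrame A g with hx
  obtain ⟨h, hB, e⟩ := x.exists_ofFrame.choose_spec.choose_spec
  set B := x.exists_ofFrame.choose_spec.choose with hBdef
  change B * Bᴴ = _
  obtain ⟨C, hC⟩ := BChi.ofFrame_fst_eq hA hB (congrArg (fun x => x.1.1) (hx.symm.trans e))
  have hCC : C.1 * C.1ᴴ = 1 := Matrix.mem_unitaryGroup_iff.1 C.2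
  rw [hC, Matrix.conjTranspose_mul, Matrix.mul_assoc, ← Matrix.mul_assoc C.1, hCC, Matrix.one_mul]

theorem BChi.proj_incl {n : ℕ} (p : Chi m n) (i j : ℕ) :
    (BChi.incl m n p).proj i j = if h : i < n ∧ j < n then p.proj ⟨i, h.1⟩ ⟨j, h.2⟩ else 0 := by
  obtain ⟨A, g, hA, h, hp⟩ := BChi.exists_ofFrame_incl p
  rw [h, BChi.proj_ofFrame hA, ← hp]
  split_ifs with hij
  · rfl
  · rw [not_and_or, not_lt, not_lt] at hij
    rw [Matrix.mul_apply]
    refine Finset.sum_eq_zero fun k _ => ?_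
    rcases hij with h | h
    · rw [hA.1 i k h, zero_mul]
    · rw [Matrix.conjTranspose_apply, hA.1 j k h, star_zero, mul_zero]

theorem BChi.continuous_matrices : Continuous fun x : BChi m => (x.proj, x.1.2) := by
  refine continuous_iSup_dom.2 fun n => continuous_coinduced_dom.2 ?_
  have hpu := (Chi.isInducing (m := m) (n := n)).continuous
  have hp : Continuous fun p : Chi m n => p.proj := continuous_fst.comp hpu
  have hu : Continuous fun p : Chi m n => p.1.2.1 := continuous_snd.comp hpu
  refine Continuous.prodMk (continuous_matrix fun i j => ?_) (continuous_matrix fun i j => ?_)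
  · simp only [BChi.proj_incl]
    split_ifs with h
    · exact hp.matrix_elem _ _
    · exact continuous_const
  · change Continuous fun p : Chi m n => padMat p.1.2.1 i j
    unfold padMat
    split_ifs with h
    · exact hu.matrix_elem _ _
    · exact continuous_const
    · exact continuous_const

theorem BChi.restrict_matrices_incl (n : ℕ) (p : Chi m n) :
    (((BChi.incl m n p).proj.submatrix Fin.val Fin.val : Matrix (Fin n) (Fin n) ℂ),
      ((BChi.incl m n p).1.2.submatrix Fin.val Fin.val : Matrix (Fin n) (Fin n) ℂ)) =
    (p.proj, p.1.2.1) := by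
  refine Prod.ext ?_ ?_
  · ext i j; simp [BChi.proj_incl]
  · ext i j
    change padMat p.1.2.1 i j = _
    simp [padMat]

/-- The `n × n` corners of the projection and of the unitary are continuous on the whole limit, and
on the `n`th stage they recover the two matrices that induce its topology. -/
theorem BChi.isEmbedding_incl (n : ℕ) : Topology.IsEmbedding (BChi.incl m n) := by
  let r : BChi m → Matrix (Fin n) (Fin n) ℂ × Matrix (Fin n) (Fin n) ℂ := fun x =>
    (x.proj.submatrix Fin.val Fin.val, x.1.2.submatrix Fin.val Fin.val)
  have hr : Continuous r :=
    ((continuous_fst.comp BChi.continuous_matrices).matrix_submatrix _ _).prodMk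
      ((continuous_snd.comp BChi.continuous_matrices).matrix_submatrix _ _)
  have hrc : r ∘ BChi.incl m n = fun p => (p.proj, p.1.2.1) :=
    funext (BChi.restrict_matrices_incl n)
  have hi : Continuous (BChi.incl m n) :=
    continuous_iSup_rng (i := n) continuous_coinduced_rng
  refine ⟨Topology.IsInducing.of_comp hi hr (hrc ▸ Chi.isInducing), ?_⟩
  refine Function.Injective.of_comp (f := r) ?_
  rw [hrc]
  intro p q h
  exact Chi.ext_proj (congrArg Prod.fst h) (congrArg Prod.snd h)

instance Chi.t1Space (n : ℕ) : T1Space (Chi m n) := by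
  refine (⟨Chi.isInducing, ?_⟩ : Topology.IsEmbedding
    fun p : Chi m n => (p.proj, (p.1.2.1 : Matrix (Fin n) (Fin n) ℂ))).t1Space
  intro p q h
  exact Chi.ext_proj (congrArg Prod.fst h) (congrArg Prod.snd h)

theorem BChi.range_incl_mono {n n' : ℕ} (h : n ≤ n') :
    Set.range (BChi.incl m n) ⊆ Set.range (BChi.incl m n') := by
  rintro _ ⟨p, rfl⟩
  obtain ⟨A, g, hA, e, -⟩ := BChi.exists_ofFrame_incl p
  rw [e, BChi.ofFrame_eq (hA.mono h)]
  exact ⟨_, rfl⟩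

/-- A compact subset of the classifying space lies in a finite stage. -/
theorem BChi.exists_range_subset {K : Type*} [TopologicalSpace K] [CompactSpace K]
    {f : K → BChi m} (hf : Continuous f) : ∃ n, Set.range f ⊆ Set.range (BChi.incl m n) := by
  by_contra! hcon
  have : ∀ n, ∃ k, f k ∉ Set.range (BChi.incl m n) := by
    intro n
    by_contra! h
    exact hcon n (by rintro _ ⟨k, rfl⟩; exact h k)
  choose x hx using this
  -- If the image escapes every stage, the tails `T n` meet each stage in a finite set and so are
  -- closed. By compactness they have a common point; it lies in some stage `N`, which `T N` avoids.
  let T : ℕ → Set (BChi m) := fun n => {y | ∃ j ≥ n, y = f (x j)}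
  have hT : ∀ n, IsClosed (T n) := by
    intro n
    rw [← isOpen_compl_iff, isOpen_iSup_iff]
    intro N
    rw [isOpen_coinduced, Set.preimage_compl, isOpen_compl_iff]
    refine Set.Finite.isClosed ?_
    refine Set.Finite.preimage (BChi.isEmbedding_incl N).injective.injOn ?_ |>.subset
      (s := BChi.incl m N ⁻¹' ((fun j => f (x j)) '' (Set.Iio N))) ?_
    · exact (Set.finite_Iio N).image _
    · rintro p ⟨j, -, hj⟩
      refine ⟨j, ?_, hj.symm⟩
      by_contra hjN
      exact hx j (BChi.range_incl_mono (not_lt.1 hjN) ⟨p, hj⟩)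
  obtain ⟨k, hk⟩ := IsCompact.nonempty_iInter_of_sequence_nonempty_isCompact_isClosed
    (fun n => f ⁻¹' T n) (fun n k ⟨j, hj, e⟩ => ⟨j, (Nat.le_succ n).trans hj, e⟩)
    (fun n => ⟨x n, n, le_rfl, rfl⟩) ((hT 0).preimage hf).isCompact
    (fun n => (hT n).preimage hf)
  rw [Set.mem_iInter] at hk
  obtain ⟨N, p, hN⟩ := (f k).2
  obtain ⟨j, hj, e⟩ := hk N
  exact hx j (BChi.range_incl_mono hj ⟨p, (Subtype.ext hN).trans e⟩)

theorem BChi.exists_lift_stage {K : Type*} [TopologicalSpace K] [CompactSpace K]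
    {f : K → BChi m} (hf : Continuous f) (n₀ : ℕ) :
    ∃ n ≥ n₀, ∃ p : K → Chi m n, Continuous p ∧ ∀ k, f k = BChi.incl m n (p k) := by
  obtain ⟨n, hn⟩ := BChi.exists_range_subset hf
  have h := hn.trans (BChi.range_incl_mono (le_max_right n₀ n))
  have : ∀ k, ∃ p, BChi.incl m (max n₀ n) p = f k := fun k => h ⟨k, rfl⟩
  choose p hp using this
  refine ⟨_, le_max_left n₀ n, p, ?_, fun k => (hp k).symm⟩
  rw [(BChi.isEmbedding_incl _).isInducing.continuous_iff]
  exact (funext hp : BChi.incl m _ ∘ p = f) ▸ hf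

end InfiniteFrames
end

noncomputable section

open Matrix

/-! ### Lifting and extension of frames in the classifying space -/

section FrameFamilies

variable {m : ℕ} {K : Type*} [TopologicalSpace K]

theorem Matrix.continuous_padRows {n : ℕ} {M : K → Matrix (Fin n) (Fin m) ℂ} (hM : Continuous M) :
    Continuous fun k => (M k).padRows := by
  refine continuous_matrix fun i j => ?_
  unfold Matrix.padRows
  split_ifs with h
  · exact hM.matrix_elem _ _
  · exact continuous_const

theorem Matrix.continuous_topRows {A : K → Matrix ℕ (Fin m) ℂ} (hA : Continuous A) (n : ℕ) :
    Continuous fun k => (A k).topRows n :=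
  continuous_matrix fun i j => hA.matrix_elem i.1 j

/-- A continuous family of frames in some fixed `ℂⁿ ⊆ ℂ^∞`. -/
def IsFrameFamily (A : K → Matrix ℕ (Fin m) ℂ) : Prop :=
  Continuous A ∧ ∃ n, ∀ k, IsFrame n (A k)

theorem isFrameFamily_stdFrame : IsFrameFamily fun _ : K => stdFrame m :=
  ⟨continuous_const, m, fun _ => isFrame_stdFrame m⟩

theorem IsFrameFamily.comp {L : Type*} [TopologicalSpace L] {A : K → Matrix ℕ (Fin m) ℂ}
    (hA : IsFrameFamily A) {φ : L → K} (hφ : Continuous φ) : IsFrameFamily fun l => A (φ l) :=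
  ⟨hA.1.comp hφ, hA.2.imp fun _ h l => h (φ l)⟩

theorem IsFrameFamily.mul_unitary {A : K → Matrix ℕ (Fin m) ℂ} (hA : IsFrameFamily A) {C : K → U m}
    (hC : Continuous C) : IsFrameFamily fun k => A k * (C k).1 :=
  ⟨hA.1.matrix_mul (continuous_subtype_val.comp hC), hA.2.imp fun _ h k => (h k).mul_unitary _⟩

theorem continuous_chiOf {n : ℕ} {M : K → Matrix (Fin n) (Fin m) ℂ} (hM : Continuous M)
    (h : ∀ k, (M k)ᴴ * M k = 1) {g : K → U m} (hg : Continuous g) :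
    Continuous fun k => chiOf (M k) (h k) (g k) := by
  have hMH := hM.matrix_conjTranspose
  have hg' : Continuous fun k => (g k).1 := continuous_subtype_val.comp hg
  rw [Chi.isInducing.continuous_iff]
  refine Continuous.prodMk ?_ ?_
  · simp only [chiOf_proj]
    exact hM.matrix_mul hMH
  · change Continuous fun k => frameUnitary (M k) (g k).1
    exact ((hM.matrix_mul hg').matrix_mul hMH).add (continuous_const.sub (hM.matrix_mul hMH))

theorem IsFrameFamily.continuous_ofFrame {A : K → Matrix ℕ (Fin m) ℂ} (hA : IsFrameFamily A)
    {g : K → U m} (hg : Continuous g) : Continuous fun k => BChi.ofFrame (A k) (g k) := by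
  obtain ⟨hc, n, hn⟩ := hA
  have e : (fun k => BChi.ofFrame (A k) (g k)) =
      fun k => BChi.incl m n (chiOf ((A k).topRows n) (hn k).2 (g k)) :=
    funext fun k => BChi.ofFrame_eq (hn k) (g k)
  rw [e]
  exact (BChi.isEmbedding_incl n).continuous.comp
    (continuous_chiOf (Matrix.continuous_topRows hc n) _ hg)

-- `P - B * Bᴴ` is a self-adjoint idempotent `D` of trace `m - m = 0`; then `Dᴴ * D = D` has trace
-- zero, which forces `D = 0`.
open scoped ComplexOrder in
theorem Matrix.eq_of_projection_mul_eq {n : ℕ} {P : Matrix (Fin n) (Fin n) ℂ}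
    {A B : Matrix (Fin n) (Fin m) ℂ} (hA : Aᴴ * A = 1) (hP : A * Aᴴ = P) (hB : Bᴴ * B = 1)
    (hPB : P * B = B) : B * Bᴴ = P := by
  have hPH : Pᴴ = P := by rw [← hP]; simp
  have hPP : P * P = P := by
    rw [← hP, Matrix.mul_assoc, ← Matrix.mul_assoc Aᴴ, hA, Matrix.one_mul]
  have hBP : Bᴴ * P = Bᴴ := by
    have := congrArg Matrix.conjTranspose hPB
    rwa [Matrix.conjTranspose_mul, hPH] at this
  have hD : (P - B * Bᴴ)ᴴ * (P - B * Bᴴ) = P - B * Bᴴ := by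
    rw [Matrix.conjTranspose_sub, hPH, Matrix.conjTranspose_mul, Matrix.conjTranspose_conjTranspose,
      Matrix.sub_mul, Matrix.mul_sub, Matrix.mul_sub, hPP, ← Matrix.mul_assoc P, hPB,
      Matrix.mul_assoc B Bᴴ P, hBP, Matrix.mul_assoc B Bᴴ, ← Matrix.mul_assoc Bᴴ B, hB,
      Matrix.one_mul, sub_self, sub_zero]
  have ht : (P - B * Bᴴ).trace = 0 := by
    rw [Matrix.trace_sub, ← hP, Matrix.trace_mul_comm A, Matrix.trace_mul_comm B, hA, hB, sub_self]
  rw [← hD] at ht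
  exact (sub_eq_zero.1 (Matrix.trace_conjTranspose_mul_self_eq_zero_iff.1 ht)).symm

/-- Homotopies in the classifying space lift to frames; the lift is stationary where the homotopy
is. -/
theorem BChi.exists_frame_lift [CompactSpace K] {f : K × I → BChi m} (hf : Continuous f)
    {A : K → Matrix ℕ (Fin m) ℂ} (hA : IsFrameFamily A) {g : K → U m}
    (h0 : ∀ k, f (k, 0) = BChi.ofFrame (A k) (g k)) :
    ∃ (B : K × I → Matrix ℕ (Fin m) ℂ) (G : K × I → U m), IsFrameFamily B ∧ Continuous G ∧
      (∀ p, f p = BChi.ofFrame (B p) (G p)) ∧ (∀ k, B (k, 0) = A k) ∧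
      ∀ k, (∀ t, f (k, t) = f (k, 0)) → ∀ t, B (k, t) = A k := by
  obtain ⟨hAc, n₀, hn₀⟩ := hA
  obtain ⟨n, hn, q, hq, hfq⟩ := BChi.exists_lift_stage hf n₀
  have hAn : ∀ k, IsFrame n (A k) := fun k => (hn₀ k).mono hn
  have hpu := Chi.isInducing.continuous.comp hq
  have hP : Continuous fun p => (q p).proj := continuous_fst.comp hpu
  have hu : Continuous fun p => (q p).1.2.1 := continuous_snd.comp hpu
  have hq0 : ∀ k, q (k, 0) = chiOf ((A k).topRows n) (hAn k).2 (g k) := fun k =>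
    (BChi.isEmbedding_incl n).injective (by rw [← hfq, h0, BChi.ofFrame_eq (hAn k)])
  have hPP : ∀ p, (q p).proj * (q p).proj = (q p).proj := by
    intro p
    obtain ⟨M, hM, h⟩ := (q p).exists_frame
    rw [← h, Matrix.mul_assoc, ← Matrix.mul_assoc Mᴴ, hM, Matrix.one_mul]
  obtain ⟨B, hB, hBB, hPB, hB0, hst⟩ := exists_frame_transport hP hPP
    (Matrix.continuous_topRows hAc n) (fun k => (hAn k).2) (fun k => by
      simp only [hq0, chiOf_proj]
      rw [Matrix.mul_assoc, (hAn k).2, Matrix.mul_one])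
  have hBP : ∀ p, B p * (B p)ᴴ = (q p).proj := by
    intro p
    obtain ⟨M, hM, h⟩ := (q p).exists_frame
    exact Matrix.eq_of_projection_mul_eq hM h (hBB p) (hPB p)
  -- `hG` expresses `G` through the frame and the unitary, whence its continuity below.
  choose G hG hqG using fun p => (q p).exists_eq_chiOf (hBB p) (hBP p)
  have hpad : ∀ k, ((A k).topRows n).padRows = A k := by
    intro k
    ext i j
    unfold Matrix.padRows
    split_ifs with h
    · rfl
    · exact ((hAn k).1 i j (not_lt.1 h)).symm
  refine ⟨fun p => (B p).padRows, G, ⟨Matrix.continuous_padRows hB, n, fun p =>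
    isFrame_padRows (hBB p)⟩, ?_, fun p => ?_, fun k => ?_, fun k h t => ?_⟩
  · refine continuous_induced_rng.2 ?_
    have : (Subtype.val ∘ G) = fun p => (B p)ᴴ * (q p).1.2.1 * B p := funext hG
    rw [this]
    exact (hB.matrix_conjTranspose.matrix_mul hu).matrix_mul hB
  · rw [hfq, BChi.ofFrame_eq (isFrame_padRows (hBB p))]
    nth_rewrite 1 [hqG p]
    simp only [Matrix.topRows_padRows]
  · simp only [hB0, hpad]
  · have hq' : ∀ t, q (k, t) = q (k, 0) := fun t =>
      (BChi.isEmbedding_incl n).injective (by rw [← hfq, ← hfq, h t])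
    simp only [hst k (fun t => by rw [hq' t]) t, hpad]

/-- Frames over a closed set extend. -/
theorem exists_isFrameFamily_extension {K : Type*} [MetricSpace K] {C : Set K} (hC : IsClosed C)
    (hne : C.Nonempty) {A : K → Matrix ℕ (Fin m) ℂ} (hA : ContinuousOn A C) {n : ℕ}
    (hn : ∀ k ∈ C, IsFrame n (A k)) :
    ∃ B : K → Matrix ℕ (Fin m) ℂ, IsFrameFamily B ∧ ∀ k ∈ C, B k = A k := by
  have hA' : ContinuousOn (fun k => (A k).topRows n) C := by
    rw [continuousOn_iff_continuous_domRestrict] at hA ⊢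
    exact Matrix.continuous_topRows hA n
  obtain ⟨B, hB, hBB, hBA⟩ := exists_frame_extension hC hne hA' fun k hk => (hn k hk).2
  -- The `m` added rows are placed after the first `n`; on `C` they are zero, so padding gives back
  -- `A`.
  let M : K → Matrix (Fin (n + m)) (Fin m) ℂ := fun k => (B k).submatrix finSumFinEquiv.symm id
  have hM : ∀ k, (M k)ᴴ * M k = 1 := by
    intro k
    rw [Matrix.conjTranspose_submatrix, Matrix.submatrix_mul_equiv, hBB, Matrix.submatrix_id_id]
  refine ⟨fun k => (M k).padRows, ⟨Matrix.continuous_padRows (hB.matrix_submatrix _ _), n + m,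
    fun k => isFrame_padRows (hM k)⟩, fun k hk => ?_⟩
  ext i j
  simp only [Matrix.padRows, M, hBA k hk]
  by_cases hi : i < n
  · rw [dif_pos (by omega)]
    have : (⟨i, by omega⟩ : Fin (n + m)) = Fin.castAdd m ⟨i, hi⟩ := rfl
    rw [this, Matrix.submatrix_apply, finSumFinEquiv_symm_apply_castAdd]
    rfl
  · rw [(hn k hk).1 i j (not_lt.1 hi)]
    split_ifs with h
    · have : (⟨i, h⟩ : Fin (n + m)) = Fin.natAdd n ⟨i - n, by omega⟩ := by
        ext; simp; omega
      rw [this, Matrix.submatrix_apply, finSumFinEquiv_symm_apply_natAdd]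
      rfl
    · rfl

end FrameFamilies
end

noncomputable section

open Matrix

/-! ### The relation between loops `f` and pairs `(g, h)` -/

section FramedLoops

variable {m l : ℕ}

/-- The base point of the classifying space. -/
def BChi.base (m : ℕ) : BChi m := BChi.ofFrame (stdFrame m) 1

theorem BChi.ofFrame_eq_base {n : ℕ} {A : Matrix ℕ (Fin m) ℂ} (hA : IsFrame n A) {g : U m}
    (e : BChi.ofFrame A g = BChi.base m) :
    g = 1 ∧ A.topRows m ∈ Matrix.unitaryGroup (Fin m) ℂ ∧ A = stdFrame m * A.topRows m :=
  BChi.ofFrame_eq_std hA e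

/-- The point of the cube without its first coordinate. -/
def Cube.tail (x : Fin (l + 1) → I) : Fin l → I := fun i => x i.succ

theorem Cube.tail_cons (t : I) (k : Fin l → I) :
    Cube.tail (Fin.cons t k : Fin (l + 1) → I) = k := rfl

theorem Cube.cons_tail (x : Fin (l + 1) → I) : Fin.cons (x 0) (Cube.tail x) = x :=
  Fin.cons_self_tail x

theorem Cube.mem_boundary_succ {x : Fin (l + 1) → I} :
    x ∈ Cube.boundary (Fin (l + 1)) ↔
      x 0 = 0 ∨ x 0 = 1 ∨ Cube.tail x ∈ Cube.boundary (Fin l) := by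
  simp only [Cube.boundary, Set.mem_ofPred_eq, Fin.exists_fin_succ, or_assoc]
  rfl

theorem Cube.isClosed_boundary (N : Type*) [Finite N] : IsClosed (Cube.boundary N) := by
  have : Cube.boundary N = ⋃ i, {y : N → I | y i = 0 ∨ y i = 1} := by
    ext y; simp [Cube.boundary]
  rw [this]
  exact isClosed_iUnion_of_finite fun i =>
    (isClosed_eq (continuous_apply i) continuous_const).union
      (isClosed_eq (continuous_apply i) continuous_const)

theorem Cube.continuous_tail : Continuous fun x : Fin (l + 1) → I => Cube.tail x :=
  continuous_pi fun i => continuous_apply i.succ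

theorem Cube.continuous_cons :
    Continuous fun p : (Fin l → I) × I => (Fin.cons p.2 p.1 : Fin (l + 1) → I) :=
  continuous_pi fun i => by
    refine Fin.cases ?_ (fun i => ?_) i
    · simpa using continuous_snd
    · simp only [Fin.cons_succ]; fun_prop

/-- A loop `f` in the classifying space is framed by `(g, h)` if it is given by frames which are
standard on the boundary, except for the face `x 0 = 1` on which they are rotated by `h`, and by the
unitaries `g` in these frames. -/
def IsFramedBy (f : Ω^ (Fin (l + 1)) (BChi m) (BChi.base m)) (g : Ω^ (Fin (l + 1)) (U m) 1)
    (h : Ω^ (Fin l) (U m) 1) : Prop :=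
  ∃ A : (Fin (l + 1) → I) → Matrix ℕ (Fin m) ℂ, IsFrameFamily A ∧
    (∀ x, f x = BChi.ofFrame (A x) (g x)) ∧ (∀ x, x 0 = 0 → A x = stdFrame m) ∧
    (∀ x, Cube.tail x ∈ Cube.boundary (Fin l) → A x = stdFrame m) ∧
    ∀ x, x 0 = 1 → A x = stdFrame m * (h (Cube.tail x)).1

theorem IsFramedBy.apply_boundary {f : Ω^ (Fin (l + 1)) (BChi m) (BChi.base m)}
    {A : (Fin (l + 1) → I) → Matrix ℕ (Fin m) ℂ} (hA : IsFrameFamily A)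
    {g : (Fin (l + 1) → I) → U m} (hf : ∀ x, f x = BChi.ofFrame (A x) (g x))
    {x : Fin (l + 1) → I} (hx : x ∈ Cube.boundary _) : g x = 1 := by
  obtain ⟨n, hn⟩ := hA.2
  exact (BChi.ofFrame_eq_base (hn x) ((hf x).symm.trans (f.2 x hx))).1

/-- The first coordinate serves as time for a lift starting at the standard frame. It is stationary
where the tail is on the boundary, and the frames at time `1` lie over the base point, hence are
rotations of the standard frame. -/
theorem exists_isFramedBy (f : Ω^ (Fin (l + 1)) (BChi m) (BChi.base m)) :
    ∃ g h, IsFramedBy f g h := by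
  have hf : Continuous fun p : (Fin l → I) × I => f (Fin.cons p.2 p.1) :=
    f.1.continuous.comp Cube.continuous_cons
  obtain ⟨B, G, hB, hG, hfB, hB0, hst⟩ := BChi.exists_frame_lift hf
    (isFrameFamily_stdFrame (m := m)) (g := fun _ => 1) (fun k => GenLoop.boundary f _ ⟨0, Or.inl rfl⟩)
  have hsplit : Continuous fun x : Fin (l + 1) → I => (Cube.tail x, x 0) :=
    Cube.continuous_tail.prodMk (continuous_apply 0)
  have hA := hB.comp hsplit
  have hfA : ∀ x, f x = BChi.ofFrame (B (Cube.tail x, x 0)) (G (Cube.tail x, x 0)) := fun x => by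
    rw [← hfB, Cube.cons_tail]
  obtain ⟨n, hn⟩ := hB.2
  have h1 : ∀ k, (B (k, 1)).topRows m ∈ Matrix.unitaryGroup (Fin m) ℂ ∧
      B (k, 1) = stdFrame m * (B (k, 1)).topRows m := fun k =>
    (BChi.ofFrame_eq_base (hn _) ((hfB (k, 1)).symm.trans (f.2 _ ⟨0, Or.inr rfl⟩))).2
  have hbd : ∀ k ∈ Cube.boundary (Fin l), ∀ t, B (k, t) = stdFrame m := by
    intro k hk
    refine hst k fun t => ?_
    dsimp only
    rw [GenLoop.boundary f _ (Cube.mem_boundary_succ.2 (Or.inr (Or.inr (by rwa [Cube.tail_cons])))),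
      GenLoop.boundary f _ (Cube.mem_boundary_succ.2 (Or.inl rfl))]
  refine ⟨⟨⟨fun x => G (Cube.tail x, x 0), hG.comp hsplit⟩, fun x hx =>
    IsFramedBy.apply_boundary hA hfA hx⟩,
    ⟨⟨fun k => ⟨(B (k, 1)).topRows m, (h1 k).1⟩, ?_⟩, fun k hk => Subtype.ext ?_⟩,
    _, hA, hfA, fun x hx => ?_, fun x hx => hbd _ hx _, fun x hx => ?_⟩
  · exact Continuous.subtype_mk (Matrix.continuous_topRows
      (hB.1.comp (continuous_id.prodMk continuous_const)) m) _
  · change (B (k, 1)).topRows m = 1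
    rw [hbd k hk 1, stdFrame, Matrix.topRows_padRows]
  · rw [hx, hB0]
  · rw [hx]; exact (h1 _).2

/-- The frames are prescribed on the boundary only and extended inside by adding dimensions. On the
boundary `g` is `1`, so rotated frames still give the base point. -/
theorem exists_isFramedBy_of_unitary (g : Ω^ (Fin (l + 1)) (U m) 1)
    (h : Ω^ (Fin l) (U m) 1) : ∃ f : Ω^ (Fin (l + 1)) (BChi m) (BChi.base m), IsFramedBy f g h := by
  let C1 : Set (Fin (l + 1) → I) := {x | x 0 = 1}
  -- On the overlap with `C1` the tail is on the boundary, where `h` is `1`, so the two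
  -- prescriptions agree.
  let C2 : Set (Fin (l + 1) → I) := {x | x 0 = 0} ∪ Cube.tail ⁻¹' Cube.boundary (Fin l)
  have hC1 : IsClosed C1 := isClosed_eq (continuous_apply 0) continuous_const
  have hC2 : IsClosed C2 := (isClosed_eq (continuous_apply 0) continuous_const).union
    ((Cube.isClosed_boundary _).preimage Cube.continuous_tail)
  classical
  let A : (Fin (l + 1) → I) → Matrix ℕ (Fin m) ℂ := fun x =>
    if x 0 = 1 then stdFrame m * (h (Cube.tail x)).1 else stdFrame m
  have hA1 : ∀ x ∈ C1, A x = stdFrame m * (h (Cube.tail x)).1 := fun x hx => if_pos hx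
  have hA2 : ∀ x ∈ C2, A x = stdFrame m := by
    intro x hx
    simp only [A]
    split_ifs with h1
    · rcases hx with hx | hx
      · rw [Set.mem_ofPred_eq, h1] at hx
        exact absurd hx one_ne_zero
      · rw [GenLoop.boundary h _ hx]; simp
    · rfl
  have hstd := (isFrameFamily_stdFrame (m := m) (K := Fin (l + 1) → I)).mul_unitary
    (h.1.continuous.comp Cube.continuous_tail)
  have hcont : ContinuousOn A (C1 ∪ C2) :=
    (hstd.1.continuousOn.congr hA1).union_of_isClosed (continuousOn_const.congr hA2) hC1 hC2
  have hn : ∀ x ∈ C1 ∪ C2, IsFrame m (A x) := by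
    rintro x (hx | hx)
    · rw [hA1 x hx]; exact (isFrame_stdFrame m).mul_unitary _
    · rw [hA2 x hx]; exact isFrame_stdFrame m
  obtain ⟨B, hB, hBA⟩ := exists_isFrameFamily_extension (hC1.union hC2) ⟨fun _ => 1, Or.inl rfl⟩
    hcont hn
  have hB1 : ∀ x, x 0 = 1 → B x = stdFrame m * (h (Cube.tail x)).1 := fun x hx =>
    (hBA x (Or.inl hx)).trans (hA1 x hx)
  have hB2 : ∀ x ∈ C2, B x = stdFrame m := fun x hx => (hBA x (Or.inr hx)).trans (hA2 x hx)
  refine ⟨⟨⟨fun x => BChi.ofFrame (B x) (g x), hB.continuous_ofFrame g.1.continuous⟩,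
    fun x hx => ?_⟩, B, hB, fun _ => rfl, fun x hx => hB2 x (Or.inl hx),
    fun x hx => hB2 x (Or.inr hx), hB1⟩
  change BChi.ofFrame (B x) (g x) = _
  rw [GenLoop.boundary g x hx]
  rcases Cube.mem_boundary_succ.1 hx with h0 | h0 | h0
  · rw [hB2 x (Or.inl h0)]; rfl
  · rw [hB1 x h0]; exact BChi.ofFrame_std_mul _
  · rw [hB2 x (Or.inr h0)]; rfl

/-- The null homotopy of `f` is lifted from the frames `A`, keeping them fixed on the boundary. The
unitary part contracts `g`. The final frames are rotations of the standard one, and these rotations,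
read along the first coordinate, deform the constant loop into `h`. -/
theorem IsFramedBy.homotopic_const {f : Ω^ (Fin (l + 1)) (BChi m) (BChi.base m)}
    {g : Ω^ (Fin (l + 1)) (U m) 1} {h : Ω^ (Fin l) (U m) 1} (hR : IsFramedBy f g h)
    (hf : GenLoop.Homotopic f GenLoop.const) :
    GenLoop.Homotopic g GenLoop.const ∧ GenLoop.Homotopic h GenLoop.const := by
  obtain ⟨A, hA, hfA, hA0, hAb, hA1⟩ := hR
  obtain ⟨F, hF, hF0, hF1, hFb⟩ := hf.exists_fun
  have hF' : Continuous fun p : (Fin (l + 1) → I) × I => F (p.2, p.1) := by fun_prop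
  obtain ⟨B, G, hB, hG, hFB, hB0, hst⟩ := BChi.exists_frame_lift hF' hA (g := g)
    (fun k => (hF0 k).trans (hfA k))
  obtain ⟨n, hn⟩ := hB.2
  have hbd : ∀ x ∈ Cube.boundary (Fin (l + 1)), ∀ t, B (x, t) = A x := fun x hx =>
    hst x fun t => (hFb t x hx).trans (hFb 0 x hx).symm
  have h1 : ∀ x, G (x, 1) = 1 ∧ (B (x, 1)).topRows m ∈ Matrix.unitaryGroup (Fin m) ℂ ∧
      B (x, 1) = stdFrame m * (B (x, 1)).topRows m := fun x =>
    BChi.ofFrame_eq_base (hn _) ((hFB (x, 1)).symm.trans (hF1 x))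
  have htop : (stdFrame m).topRows m = 1 := by rw [stdFrame, Matrix.topRows_padRows]
  constructor
  · refine GenLoop.homotopic_of (fun p => G (p.2, p.1)) (by fun_prop) (fun x => ?_)
      (fun x => (h1 x).1) (fun t x hx => ?_)
    · have e := (hFB (x, 0)).symm.trans ((hF0 x).trans (hfA x))
      rw [hB0] at e
      have := hn (x, 0)
      rw [hB0] at this
      exact BChi.ofFrame_right_injective this e
    · exact (BChi.ofFrame_eq_base (hn _) ((hFB (x, t)).symm.trans (hFb t x hx))).1
  · refine GenLoop.Homotopic.symm (GenLoop.homotopic_of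
      (fun p => ⟨(B (Fin.cons p.1 p.2, 1)).topRows m, (h1 _).2.1⟩) ?_ (fun x => Subtype.ext ?_)
      (fun x => Subtype.ext ?_) (fun t x hx => Subtype.ext ?_))
    · refine Continuous.subtype_mk (Matrix.continuous_topRows (hB.1.comp ?_) m) _
      exact (Cube.continuous_cons.comp continuous_swap).prodMk continuous_const
    · change (B (Fin.cons 0 x, 1)).topRows m = 1
      rw [hbd _ (Cube.mem_boundary_succ.2 (Or.inl rfl)), hA0 _ rfl, htop]
    · change (B (Fin.cons 1 x, 1)).topRows m = (h x).1
      rw [hbd _ (Cube.mem_boundary_succ.2 (Or.inr (Or.inl rfl))), hA1 _ rfl, Cube.tail_cons,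
        topRows_stdFrame_mul]
    · change (B (Fin.cons t x, 1)).topRows m = 1
      rw [hbd _ (Cube.mem_boundary_succ.2 (Or.inr (Or.inr (by rwa [Cube.tail_cons])))),
        hAb _ (by rwa [Cube.tail_cons]), htop]

/-- On cube times interval, frames are prescribed at the bottom by `A`, on the face `x 0 = 1` by the
contraction of `h`, and as standard at the top and on the other sides. Their extension, paired with
the contraction of `g`, contracts `f`. -/
theorem IsFramedBy.homotopic_const_of_unitary
    {f : Ω^ (Fin (l + 1)) (BChi m) (BChi.base m)}
    {g : Ω^ (Fin (l + 1)) (U m) 1} {h : Ω^ (Fin l) (U m) 1} (hR : IsFramedBy f g h)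
    (hg : GenLoop.Homotopic g GenLoop.const) (hh : GenLoop.Homotopic h GenLoop.const) :
    GenLoop.Homotopic f GenLoop.const := by
  obtain ⟨A, hA, hfA, hA0, hAb, hA1⟩ := hR
  obtain ⟨G, hG, hG0, hG1, hGb⟩ := hg.exists_fun
  obtain ⟨H, hH, hH0, hH1, hHb⟩ := hh.exists_fun
  obtain ⟨n, hn⟩ := hA.2
  let C1 : Set (I × (Fin (l + 1) → I)) := {p | p.1 = 0}
  let C2 : Set (I × (Fin (l + 1) → I)) := {p | p.2 0 = 1}
  let C3 : Set (I × (Fin (l + 1) → I)) :=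
    {p | p.1 = 1} ∪ ({p | p.2 0 = 0} ∪ {p | Cube.tail p.2 ∈ Cube.boundary (Fin l)})
  have ht : Continuous fun p : I × (Fin (l + 1) → I) => Cube.tail p.2 :=
    Cube.continuous_tail.comp continuous_snd
  have hx0 : Continuous fun p : I × (Fin (l + 1) → I) => p.2 0 := by fun_prop
  have hC1 : IsClosed C1 := isClosed_eq continuous_fst continuous_const
  have hC2 : IsClosed C2 := isClosed_eq hx0 continuous_const
  have hC3 : IsClosed C3 := (isClosed_eq continuous_fst continuous_const).union
    ((isClosed_eq hx0 continuous_const).union ((Cube.isClosed_boundary _).preimage ht))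
  have hHc : Continuous fun p : I × (Fin (l + 1) → I) => H (p.1, Cube.tail p.2) :=
    hH.comp (continuous_fst.prodMk ht)
  classical
  let E : I × (Fin (l + 1) → I) → Matrix ℕ (Fin m) ℂ := fun p =>
    if p.1 = 0 then A p.2 else if p.2 0 = 1 then stdFrame m * (H (p.1, Cube.tail p.2)).1
      else stdFrame m
  have hE1 : ∀ p ∈ C1, E p = A p.2 := fun p hp => if_pos hp
  have hE2 : ∀ p ∈ C2, E p = stdFrame m * (H (p.1, Cube.tail p.2)).1 := by
    rintro ⟨s, x⟩ hx
    change x 0 = 1 at hx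
    simp only [E, hx, if_true]
    split_ifs with hs
    · rw [hs, hA1 x hx, hH0]
    · rfl
  have hE3 : ∀ p ∈ C3, E p = stdFrame m := by
    rintro ⟨s, x⟩ hp
    by_cases hs : s = 0
    · rw [hE1 _ hs]
      rcases hp with hp | hp | hp
      · exact absurd ((show s = 1 from hp).symm.trans hs) one_ne_zero
      · exact hA0 x hp
      · exact hAb x hp
    · by_cases hx : x 0 = 1
      · rw [hE2 _ hx]
        have : H (s, Cube.tail x) = 1 := by
          rcases hp with hp | hp | hp
          · rw [show s = 1 from hp]; exact hH1 _
          · exact absurd (hx.symm.trans hp) one_ne_zero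
          · exact hHb s _ hp
        simp [this]
      · simp [E, hs, hx]
  have hstd := (isFrameFamily_stdFrame (m := m)).mul_unitary hHc
  have hcont : ContinuousOn E (C1 ∪ (C2 ∪ C3)) :=
    ((hA.1.comp continuous_snd).continuousOn.congr hE1).union_of_isClosed
      ((hstd.1.continuousOn.congr hE2).union_of_isClosed (continuousOn_const.congr hE3) hC2 hC3)
      hC1 (hC2.union hC3)
  have hnE : ∀ p ∈ C1 ∪ (C2 ∪ C3), IsFrame (max n m) (E p) := by
    have hm := (isFrame_stdFrame m).mono (le_max_right n m)
    rintro p (hp | hp | hp)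
    · rw [hE1 p hp]; exact (hn _).mono (le_max_left n m)
    · rw [hE2 p hp]; exact hm.mul_unitary _
    · rw [hE3 p hp]; exact hm
  obtain ⟨B, hB, hBE⟩ := exists_isFrameFamily_extension (hC1.union (hC2.union hC3))
    ⟨(0, fun _ => 0), Or.inl rfl⟩ hcont hnE
  have hB1 : ∀ p ∈ C1, B p = A p.2 := fun p hp => (hBE p (Or.inl hp)).trans (hE1 p hp)
  have hB2 : ∀ p ∈ C2, B p = stdFrame m * (H (p.1, Cube.tail p.2)).1 := fun p hp =>
    (hBE p (Or.inr (Or.inl hp))).trans (hE2 p hp)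
  have hB3 : ∀ p ∈ C3, B p = stdFrame m := fun p hp =>
    (hBE p (Or.inr (Or.inr hp))).trans (hE3 p hp)
  refine GenLoop.homotopic_of (fun p => BChi.ofFrame (B p) (G p)) (hB.continuous_ofFrame hG)
    (fun x => ?_) (fun x => ?_) (fun s x hx => ?_)
  · rw [hB1 _ rfl, hG0, hfA]
  · rw [hB3 _ (Or.inl rfl), hG1]; rfl
  · rw [hGb s x hx]
    rcases Cube.mem_boundary_succ.1 hx with h0 | h0 | h0
    · rw [hB3 _ (Or.inr (Or.inl h0))]; rfl
    · rw [hB2 _ h0]; exact BChi.ofFrame_std_mul _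
    · rw [hB3 _ (Or.inr (Or.inr h0))]; rfl

/-- The frames `A` and `A'` glued along the `i`th coordinate. -/
def glueAt (i : Fin l) (A A' : (Fin l → I) → Matrix ℕ (Fin m) ℂ) (x : Fin l → I) :
    Matrix ℕ (Fin m) ℂ :=
  if (x i : ℝ) ≤ 1 / 2
    then A (Function.update x i <| Set.projIcc 0 1 zero_le_one (2 * x i))
    else A' (Function.update x i <| Set.projIcc 0 1 zero_le_one (2 * x i - 1))

theorem isFrameFamily_glueAt (i : Fin l) {A A' : (Fin l → I) → Matrix ℕ (Fin m) ℂ}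
    (hA : IsFrameFamily A) (hA' : IsFrameFamily A') (h1 : ∀ x, x i = 1 → A x = stdFrame m)
    (h0 : ∀ x, x i = 0 → A' x = stdFrame m) : IsFrameFamily (glueAt i A A') := by
  obtain ⟨n, hn⟩ := hA.2
  obtain ⟨n', hn'⟩ := hA'.2
  refine ⟨?_, max n n', fun x => ?_⟩
  · exact (continuous_glueAt (Y := Unit) i (hA.1.comp continuous_snd) (hA'.1.comp continuous_snd)
      fun _ z z' hz hz' _ => (h1 z hz).trans (h0 z' hz').symm).comp
        (continuous_const.prodMk continuous_id : Continuous fun x : Fin l → I => ((), x))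
  · unfold glueAt
    split_ifs
    · exact (hn _).mono (le_max_left _ _)
    · exact (hn' _).mono (le_max_right _ _)

theorem transAt_eq_ofFrame_glueAt (i : Fin l) {f f' : Ω^ (Fin l) (BChi m) (BChi.base m)}
    {g g' : Ω^ (Fin l) (U m) 1} {A A' : (Fin l → I) → Matrix ℕ (Fin m) ℂ}
    (hf : ∀ x, f x = BChi.ofFrame (A x) (g x)) (hf' : ∀ x, f' x = BChi.ofFrame (A' x) (g' x))
    (x : Fin l → I) :
    GenLoop.transAt i f f' x = BChi.ofFrame (glueAt i A A' x) (GenLoop.transAt i g g' x) := by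
  rw [GenLoop.transAt_apply, GenLoop.transAt_apply, glueAt]
  split_ifs
  · exact hf _
  · exact hf' _

theorem Cube.tail_update_one (x : Fin (l + 2) → I) (t : I) :
    Cube.tail (Function.update x 1 t) = Function.update (Cube.tail x) 0 t :=
  Fin.tail_update_succ x 0 t

/-- Concatenation avoids coordinate `0`, whose two ends carry different frames. It uses coordinate
`1`, which is coordinate `0` of the tail; both frame families are standard along the seam. -/
theorem IsFramedBy.transAt {f f' : Ω^ (Fin (l + 2)) (BChi m) (BChi.base m)}
    {g g' : Ω^ (Fin (l + 2)) (U m) 1} {h h' : Ω^ (Fin (l + 1)) (U m) 1} (hR : IsFramedBy f g h)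
    (hR' : IsFramedBy f' g' h') :
    IsFramedBy (GenLoop.transAt 1 f f') (GenLoop.transAt 1 g g') (GenLoop.transAt 0 h h') := by
  obtain ⟨A, hA, hfA, hA0, hAb, hA1⟩ := hR
  obtain ⟨A', hA', hfA', hA0', hAb', hA1'⟩ := hR'
  have h01 : (0 : Fin (l + 2)) ≠ 1 := by simp
  refine ⟨glueAt 1 A A', isFrameFamily_glueAt 1 hA hA' (fun x hx => hAb x ⟨0, Or.inr hx⟩)
    (fun x hx => hAb' x ⟨0, Or.inl hx⟩), transAt_eq_ofFrame_glueAt 1 hfA hfA', fun x hx => ?_,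
    fun x hx => ?_, fun x hx => ?_⟩
  · unfold glueAt
    split_ifs
    · exact hA0 _ (by rwa [Function.update_of_ne h01])
    · exact hA0' _ (by rwa [Function.update_of_ne h01])
  · obtain ⟨j, hj⟩ := hx
    by_cases hj0 : j = 0
    · subst hj0
      change x 1 = 0 ∨ x 1 = 1 at hj
      unfold glueAt
      rcases hj with hj | hj
      · rw [if_pos (by simp [hj])]
        refine hAb _ ⟨0, Or.inl ?_⟩
        rw [Cube.tail_update_one, Function.update_self, hj]
        simp
      · rw [if_neg (by norm_num [hj])]
        refine hAb' _ ⟨0, Or.inr ?_⟩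
        rw [Cube.tail_update_one, Function.update_self, hj]
        exact Set.projIcc_of_right_le _ (by norm_num)
    · unfold glueAt
      split_ifs
      · exact hAb _ ⟨j, by rwa [Cube.tail_update_one, Function.update_of_ne hj0]⟩
      · exact hAb' _ ⟨j, by rwa [Cube.tail_update_one, Function.update_of_ne hj0]⟩
  · have e : Cube.tail x 0 = x 1 := rfl
    rw [GenLoop.transAt_apply, glueAt, e]
    split_ifs
    · rw [hA1 _ (by rwa [Function.update_of_ne h01]), Cube.tail_update_one]
    · rw [hA1' _ (by rwa [Function.update_of_ne h01]), Cube.tail_update_one]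

/-- The frames of a loop can be chosen to be standard on the whole boundary of the interval. -/
theorem exists_isFramedBy_const (f : Ω^ (Fin 1) (BChi m) (BChi.base m)) :
    ∃ g, IsFramedBy f g GenLoop.const := by
  obtain ⟨g, h, A, hA, hfA, hA0, hAb, hA1⟩ := exists_isFramedBy f
  -- Here `h` is a single unitary; rotating the frames along a path from `1` to its inverse cancels
  -- it, at the price of conjugating `g`.
  obtain ⟨γ⟩ := joined_one_unitary (h 0)⁻¹
  have hγ : Continuous fun x : Fin 1 → I => γ (x 0) := by fun_prop
  have hB := hA.mul_unitary hγ
  have hfB : ∀ x, f x = BChi.ofFrame (A x * (γ (x 0)).1) ((γ (x 0))⁻¹ * g x * γ (x 0)) := by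
    intro x
    obtain ⟨n, hn⟩ := hA.2
    rw [BChi.ofFrame_mul (hn x), hfA]
    congr 1
    group
  refine ⟨⟨⟨_, (hγ.inv.mul g.1.continuous).mul hγ⟩, fun x hx =>
    IsFramedBy.apply_boundary hB hfB hx⟩, _, hB, hfB, fun x hx => ?_, fun x hx => ?_, fun x hx => ?_⟩
  · rw [hA0 x hx, hx, γ.source]; simp
  · exact hx.choose.elim0
  · rw [hA1 x hx, hx, γ.target, Matrix.mul_assoc]
    have : Cube.tail x = 0 := Subsingleton.elim _ _
    rw [this, ← Submonoid.coe_mul, mul_inv_cancel]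
    rfl

/-- The only coordinate is now `0`; the frames match at the seam because `h` is constant. -/
theorem IsFramedBy.transAt_const {f f' : Ω^ (Fin 1) (BChi m) (BChi.base m)}
    {g g' : Ω^ (Fin 1) (U m) 1} (hR : IsFramedBy f g GenLoop.const)
    (hR' : IsFramedBy f' g' GenLoop.const) :
    IsFramedBy (GenLoop.transAt 0 f f') (GenLoop.transAt 0 g g') GenLoop.const := by
  obtain ⟨A, hA, hfA, hA0, hAb, hA1⟩ := hR
  obtain ⟨A', hA', hfA', hA0', hAb', hA1'⟩ := hR'
  have hA1 : ∀ x, x 0 = 1 → A x = stdFrame m := fun x hx => by rw [hA1 x hx]; simp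
  have hA1' : ∀ x, x 0 = 1 → A' x = stdFrame m := fun x hx => by rw [hA1' x hx]; simp
  refine ⟨glueAt 0 A A', isFrameFamily_glueAt 0 hA hA' hA1 hA0',
    transAt_eq_ofFrame_glueAt 0 hfA hfA', fun x hx => ?_, fun x hx => hx.choose.elim0,
    fun x hx => ?_⟩
  · rw [glueAt, if_pos (by simp [hx])]
    exact hA0 _ (by simp [hx])
  · rw [glueAt, if_neg (by norm_num [hx]), GenLoop.const_apply]
    refine (hA1' _ ?_).trans (by simp)
    rw [Function.update_self, hx]
    exact Set.projIcc_of_right_le _ (by norm_num)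

end FramedLoops

/-! ### The isomorphisms at the base point and path connectedness -/

section HomotopyGroups

variable (m : ℕ)

theorem nonempty_mulEquiv_homotopyGroup_base (l : ℕ) :
    Nonempty (π_ (l + 2) (BChi m) (BChi.base m) ≃* π_ (l + 2) (U m) 1 × π_ (l + 1) (U m) 1) := by
  refine nonempty_mulEquiv_of_rel (fun a b => ∃ f g h,
    (⟦f⟧ : π_ (l + 2) (BChi m) (BChi.base m)) = a ∧
      ((⟦g⟧ : π_ (l + 2) (U m) 1), (⟦h⟧ : π_ (l + 1) (U m) 1)) = b ∧ IsFramedBy f g h) ?_ ?_ ?_ ?_ ?_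
  · rintro _ _ _ _ ⟨f, g, h, rfl, rfl, hR⟩ ⟨f', g', h', rfl, rfl, hR'⟩
    exact ⟨_, _, _, (HomotopyGroup.mul_spec (i := 1)).symm, Prod.ext
      (HomotopyGroup.mul_spec (i := 1)).symm (HomotopyGroup.mul_spec (i := 0)).symm,
      hR'.transAt hR⟩
  · rintro ⟨f⟩
    obtain ⟨g, h, hR⟩ := exists_isFramedBy f
    exact ⟨_, f, g, h, rfl, rfl, hR⟩
  · rintro ⟨⟨g⟩, ⟨h⟩⟩
    obtain ⟨f, hR⟩ := exists_isFramedBy_of_unitary g h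
    exact ⟨_, f, g, h, rfl, rfl, hR⟩
  · rintro _ ⟨f, g, h, hf, rfl, hR⟩
    obtain ⟨hg, hh⟩ := hR.homotopic_const (Quotient.exact hf)
    exact Prod.ext (Quotient.sound hg) (Quotient.sound hh)
  · rintro _ ⟨f, g, h, rfl, hgh, hR⟩
    obtain ⟨hg, hh⟩ := Prod.ext_iff.1 hgh
    exact Quotient.sound
      (hR.homotopic_const_of_unitary (Quotient.exact hg) (Quotient.exact hh))

theorem nonempty_mulEquiv_homotopyGroup_one_base :
    Nonempty (π_ 1 (BChi m) (BChi.base m) ≃* π_ 1 (U m) 1) := by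
  refine nonempty_mulEquiv_of_rel (fun a b => ∃ f g,
    (⟦f⟧ : π_ 1 (BChi m) (BChi.base m)) = a ∧ (⟦g⟧ : π_ 1 (U m) 1) = b ∧
      IsFramedBy f g GenLoop.const) ?_ ?_ ?_ ?_ ?_
  · rintro _ _ _ _ ⟨f, g, rfl, rfl, hR⟩ ⟨f', g', rfl, rfl, hR'⟩
    exact ⟨_, _, (HomotopyGroup.mul_spec (i := 0)).symm, (HomotopyGroup.mul_spec (i := 0)).symm,
      hR'.transAt_const hR⟩
  · rintro ⟨f⟩
    obtain ⟨g, hR⟩ := exists_isFramedBy_const f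
    exact ⟨_, f, g, rfl, rfl, hR⟩
  · rintro ⟨g⟩
    obtain ⟨f, hR⟩ := exists_isFramedBy_of_unitary g GenLoop.const
    exact ⟨_, f, g, rfl, rfl, hR⟩
  · rintro _ ⟨f, g, hf, rfl, hR⟩
    exact Quotient.sound (hR.homotopic_const (Quotient.exact hf)).1
  · rintro _ ⟨f, g, rfl, hg, hR⟩
    exact Quotient.sound
      (hR.homotopic_const_of_unitary (Quotient.exact hg) (GenLoop.Homotopic.refl _))

variable {m}

/-- The classifying space is path connected. -/
theorem BChi.joined_base (b : BChi m) : Joined (BChi.base m) b := by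
  obtain ⟨n, A, g, hA, rfl⟩ := b.exists_ofFrame
  obtain ⟨γ⟩ := joined_one_unitary g
  classical
  -- Frames prescribed at the two endpoints only; their extension joins the standard frame to `A`.
  let E : I → Matrix ℕ (Fin m) ℂ := fun t => if t = 0 then stdFrame m else A
  have hE : ContinuousOn E ({0} ∪ {1}) :=
    (continuousOn_singleton E 0).union_of_isClosed (continuousOn_singleton E 1)
      isClosed_singleton isClosed_singleton
  obtain ⟨B, hB, hBE⟩ := exists_isFrameFamily_extension (isClosed_singleton.union
    isClosed_singleton) ⟨0, Or.inl rfl⟩ hE (n := max n m) (by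
      rintro t -
      simp only [E]
      split_ifs
      · exact (isFrame_stdFrame m).mono (le_max_right _ _)
      · exact hA.mono (le_max_left _ _))
  refine ⟨⟨⟨fun t => BChi.ofFrame (B t) (γ t), hB.continuous_ofFrame γ.continuous⟩, ?_, ?_⟩⟩
  · change BChi.ofFrame (B 0) (γ 0) = _
    rw [hBE 0 (Or.inl rfl), γ.source]; simp [E, BChi.base]
  · change BChi.ofFrame (B 1) (γ 1) = _
    rw [hBE 1 (Or.inr rfl), γ.target]; simp [E]

end HomotopyGroups
end

/-- Here `U m ⧸ Subgroup.pathComponentOne (U m)` is the group `π₀(U(m))` of path components. -/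
theorem mainTheorem5 (m : ℕ) (hm : 1 ≤ m) :
    Nonempty (BChi m) ∧
    ∀ (b : BChi m) (g : U m),
      Subsingleton (π_ 0 (BChi m) b) ∧
      Nonempty (π_ 1 (BChi m) b ≃* π_ 1 (U m) g × (U m ⧸ Subgroup.pathComponentOne (U m))) ∧
      ∀ l : ℕ,
        Nonempty (π_ (l + 2) (BChi m) b ≃* π_ (l + 2) (U m) g × π_ (l + 1) (U m) g) := by
  refine ⟨⟨BChi.base m⟩, fun b g => ⟨?_, ?_, fun l => ?_⟩⟩
  · refine HomotopyGroup.pi0EquivZerothHomotopy.subsingleton_congr.2 ⟨?_⟩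
    rintro ⟨x⟩ ⟨y⟩
    exact Quotient.sound ((BChi.joined_base x).symm.trans (BChi.joined_base y))
  · obtain ⟨e₁⟩ := HomotopyGroup.nonempty_mulEquiv_of_joined (N := Fin 1) (BChi.joined_base b).symm
    obtain ⟨e₂⟩ := nonempty_mulEquiv_homotopyGroup_one_base m
    obtain ⟨e₃⟩ := HomotopyGroup.nonempty_mulEquiv_of_joined (N := Fin 1) (joined_one_unitary g)
    -- `U(m)` is path connected, so the factor `π₀(U(m))` is trivial and `e₂` needs no second
    -- component.
    have : Subsingleton (U m ⧸ Subgroup.pathComponentOne (U m)) :=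
      QuotientGroup.subsingleton_iff.2 (eq_top_iff.2 fun u _ => joined_one_unitary u)
    have := uniqueOfSubsingleton (1 : U m ⧸ Subgroup.pathComponentOne (U m))
    exact ⟨(e₁.trans (e₂.trans e₃)).trans MulEquiv.prodUnique.symm⟩
  · obtain ⟨e₁⟩ := HomotopyGroup.nonempty_mulEquiv_of_joined (N := Fin (l + 2))
      (BChi.joined_base b).symm
    obtain ⟨e₂⟩ := nonempty_mulEquiv_homotopyGroup_base m l
    obtain ⟨e₃⟩ := HomotopyGroup.nonempty_mulEquiv_of_joined (N := Fin (l + 2))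
      (joined_one_unitary g)
    obtain ⟨e₄⟩ := HomotopyGroup.nonempty_mulEquiv_of_joined (N := Fin (l + 1))
      (joined_one_unitary g)
    exact ⟨e₁.trans (e₂.trans (e₃.prodCongr e₄))⟩
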